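/- Let $g:\mathbb R\to\mathbb R$ be of class $C^2$ with $g,g',g''\in L^1(\mathbb R)$, and put $m_0=\int_{\mathbb R} g(s)^2\,ds$ and $m_2=\int_{\mathbb R} g'(s)^2\,ds$. For $\lambda>0$ let $\{\tau_i\}$ be the points of a Poisson point process on $\mathbb R$ with intensity $\lambda\,ds$, let $X_\lambda(t)=\sum_i \beta_i\, g(t-\tau_i)$ be the shot noise process with impulses $\beta_i=1$ almost surely, and let $$Z_\lambda(t)=\frac{1}{\sqrt\lambda}\bigl(X_\lambda(t)-\mathbb E(X_\lambda(t))\bigr),\qquad t\in\mathbb R .$$ For $\alpha\in\mathbb R$ let $C_{Z_\lambda}(\alpha,[0,1])=\mathbb E\bigl(\#\{t\in[0,1] : Z_\lambda(t)=\alpha\}\bigr)\in[0,\infty]$ be the mean number of crossings of the level $\alpha$ in $[0,1]$. Then there exist constants $a_1,a_2,a_3>0$ depending only on $g$ such that for every $\lambda>0$ the function $\alpha\mapsto C_{Z_\lambda}(\alpha,[0,1])$ is finite almost everywhere and integrable on $\mathbb R$, and its Fourier transform $\widehat{C_{Z_\lambda}}(u,[0,1])=\int_{\mathbb R}e^{iu\alpha}C_{Z_\lambda}(\alpha,[0,1])\,d\alpha$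 satisfies, for every $u\in\mathbb R$ with $|u|<a_1\sqrt\lambda$, $$\Bigl|\widehat{C_{Z_\lambda}}(u,[0,1])-\sqrt{\tfrac{2m_2}{\pi}}\;e^{-m_0u^2/2}\Bigr|\le\frac{a_2+a_3|u|}{\sqrt\lambda}.$$ -/

import Mathlib

open MeasureTheory ProbabilityTheory

noncomputable section

/-- The regularity assumption on the kernel: `g` is of class `C²` and `g`, `g'`, `g''` are
integrable on the line. -/
structure KernelAssumption (g : ℝ → ℝ) : Prop where
  contDiff : ContDiff ℝ 2 g
  integrable : Integrable g
  integrable_deriv : Integrable (deriv g)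
  integrable_deriv_deriv : Integrable (deriv (deriv g))

/-- The number of points `τ i` that fall in `A`. -/
def pointCount {Ω : Type*} (τ : ℕ → Ω → ℝ) (A : Set ℝ) (ω : Ω) : ℕ∞ :=
  {i : ℕ | τ i ω ∈ A}.encard

/-- The random points `τ 0, τ 1, …` are the points of a Poisson point process on the line with
intensity measure `ν` (of infinite total mass, since the enumeration is by `ℕ`): the number of
points in a Borel set of finite `ν`-measure has the Poisson law with parameter the `ν`-measure,
and the numbers of points in pairwise disjoint Borel sets are independent. -/
structure IsPoissonPointProcess {Ω : Type*} [MeasurableSpace Ω] (τ : ℕ → Ω → ℝ)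
    (ν : Measure ℝ) (P : Measure Ω) : Prop where
  measurable : ∀ i, Measurable (τ i)
  count_law : ∀ A : Set ℝ, MeasurableSet A → ν A ≠ ⊤ → ∀ k : ℕ,
    P {ω | pointCount τ A ω = k} = poissonMeasure (ν A).toNNReal {k}
  count_indep : ∀ (n : ℕ) (A : Fin n → Set ℝ), (∀ j, MeasurableSet (A j)) →
    Pairwise (fun j k => Disjoint (A j) (A k)) →
    iIndepFun (fun j ω => pointCount τ (A j) ω) P

/-- The shot noise process `X(t) = ∑ᵢ βᵢ g(t - τᵢ)`. -/
def shotNoise {Ω : Type*} (g : ℝ → ℝ) (β τ : ℕ → Ω → ℝ) (t : ℝ) (ω : Ω) : ℝ :=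
  ∑' i, β i ω * g (t - τ i ω)

/-- The normalized process `(X(t) - E X(t)) / √lam`. -/
def normalizedProcess {Ω : Type*} [MeasurableSpace Ω] (P : Measure Ω) (lam : ℝ)
    (X : ℝ → Ω → ℝ) (t : ℝ) (ω : Ω) : ℝ :=
  (X t ω - ∫ ω', X t ω' ∂P) / √lam

/-- The number of crossings of the level `α` by the path `f` in `[a, b]`. -/
def crossingNumber (f : ℝ → ℝ) (a b α : ℝ) : ℕ∞ :=
  {t : ℝ | t ∈ Set.Icc a b ∧ f t = α}.encard

/-- The mean number of crossings of the level `α` by the process `X` in `[a, b]`, possibly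
infinite. -/
def meanCrossings {Ω : Type*} [MeasurableSpace Ω] (P : Measure Ω) (X : ℝ → Ω → ℝ)
    (a b α : ℝ) : ENNReal :=
  ∫⁻ ω, (crossingNumber (fun t => X t ω) a b α : ENNReal) ∂P

/-- The Fourier transform `u ↦ ∫ e^{iuα} f(α) dα`. -/
def fourierPlus (f : ℝ → ℝ) (u : ℝ) : ℂ :=
  ∫ α : ℝ, Complex.exp (Complex.I * u * α) * (f α : ℂ)

end

/-!
By the area formula, the Fourier transform of the mean number of crossings of a process `Y` with
`C¹` paths is `∫₀¹ E[e^{iuY(t)} |Y'(t)|] dt`, so it is enough to compare the integrand with its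
value for independent centred Gaussian variables of variances `m₀` and `m₂`. Up to a constant,
`|y|` is the integral of `(1 - cos (v y)) / v²` over `v`. This turns the integrand into an integral
of second differences in `v` of the characteristic function of `(Y(t), Y'(t))`, which for shot noise
is `exp (∫ (e^{iθ} - 1 - iθ) ds)` with `θ(s) = (u g(t - s) + v g'(t - s)) / √λ` and `λ ds` in place
of `ds`. Since `∫ g g' = 0`, its exponent is `-(m₀ u² + m₂ v²) / 2` up to third order terms of size
`1 / √λ`. For `|v|` up to order `√λ` the second differences are compared by separating the parts
of the exponent that are even and odd in `v`, which gains the factor `v²` needed near `0`. For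
larger `|v|` they are bounded, and `∫ dv / v²` over that range is again of order `1 / √λ`.
-/

open Set Filter
open Complex (I)
open scoped ENNReal NNReal Topology Complex

section ComplexExponential

theorem norm_cexp_sub_cexp_le_of_re_le {a b : ℂ} {r : ℝ} (ha : a.re ≤ r) (hb : b.re ≤ r) :
    ‖cexp a - cexp b‖ ≤ Real.exp r * ‖a - b‖ :=
  (convex_halfSpace_re_le r).norm_image_sub_le_of_norm_hasDerivWithin_le
    (fun x _ => (Complex.hasDerivAt_exp x).hasDerivWithinAt)
    (fun x hx => by rw [Complex.norm_exp]; exact Real.exp_le_exp.2 hx) hb ha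

theorem norm_cexp_I_mul_ofReal_mul_ofReal (u y : ℝ) : ‖cexp (I * u * y)‖ = 1 := by
  rw [mul_assoc, ← Complex.ofReal_mul, Complex.norm_exp_I_mul_ofReal]

theorem norm_cexp_I_mul_sub_cexp_I_mul_le (a b : ℝ) : ‖cexp (I * a) - cexp (I * b)‖ ≤ |a - b| := by
  simpa [← mul_sub, ← Complex.ofReal_sub] using
    norm_cexp_sub_cexp_le_of_re_le (a := I * a) (b := I * b) (r := 0) (by simp) (by simp)

theorem re_cexp_I_mul_sub_one_nonpos (x : ℝ) : (cexp (I * x) - 1).re ≤ 0 := by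
  simpa [mul_comm I, Complex.exp_ofReal_mul_I_re] using Real.cos_le_one x

variable {α : Type*} [MeasurableSpace α] {μ : Measure α} {f : α → ℝ}

theorem integrable_cexp_I_mul_sub_one (hf : Integrable f μ) :
    Integrable (fun s => cexp (I * f s) - 1) μ := by
  have hm := hf.1.aemeasurable
  exact hf.mono (AEMeasurable.aestronglyMeasurable (by fun_prop))
    (Eventually.of_forall fun s => Real.norm_exp_I_mul_ofReal_sub_one_le)

theorem re_integral_cexp_I_mul_sub_one_nonpos (hf : Integrable f μ) :
    (∫ s, (cexp (I * f s) - 1) ∂μ).re ≤ 0 := by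
  have hre := integral_re (𝕜 := ℂ) (integrable_cexp_I_mul_sub_one hf)
  exact hre.symm.trans_le (integral_nonpos fun s => re_cexp_I_mul_sub_one_nonpos (f s))

theorem norm_cexp_integral_sub_le {k : α → ℝ} (hf : Integrable f μ) (hk : Integrable k μ) :
    ‖cexp (∫ s, (cexp (I * f s) - 1) ∂μ) - cexp (∫ s, (cexp (I * k s) - 1) ∂μ)‖
      ≤ ∫ s, ‖f s - k s‖ ∂μ := by
  refine (norm_cexp_sub_cexp_le_of_re_le (re_integral_cexp_I_mul_sub_one_nonpos hf)
    (re_integral_cexp_I_mul_sub_one_nonpos hk)).trans ?_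
  rw [Real.exp_zero, one_mul,
    ← integral_sub (integrable_cexp_I_mul_sub_one hf) (integrable_cexp_I_mul_sub_one hk)]
  refine norm_integral_le_of_norm_le (hf.sub hk).norm (Eventually.of_forall fun s => ?_)
  rw [sub_sub_sub_cancel_right]
  exact norm_cexp_I_mul_sub_cexp_I_mul_le _ _

end ComplexExponential

section PoissonPointProcess

theorem lintegral_natCast_poissonMeasure (r : ℝ≥0) :
    ∫⁻ k, (k : ℝ≥0∞) ∂(poissonMeasure r) = r := by
  have hsucc (n : ℕ) : Real.exp (-r) * r ^ (n + 1) / (n + 1).factorial * ((n + 1 : ℕ) : ℝ)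
      = r * (Real.exp (-r) * r ^ n / n.factorial) := by
    rw [Nat.factorial_succ]
    push_cast
    field_simp
    ring
  have hsum : HasSum (fun n : ℕ => Real.exp (-r) * r ^ n / n.factorial * (n : ℝ)) (r : ℝ) := by
    rw [← hasSum_nat_add_iff' 1]
    simpa only [Finset.sum_range_one, Nat.cast_zero, mul_zero, sub_zero, hsucc, mul_one] using
      (hasSum_one_poissonMeasure r).mul_left (r : ℝ)
  have hterm (n : ℕ) : ENNReal.ofReal (Real.exp (-r) * r ^ n / n.factorial) * (n : ℝ≥0∞)
      = ENNReal.ofReal (Real.exp (-r) * r ^ n / n.factorial * n) := by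
    rw [ENNReal.ofReal_mul (by positivity), ENNReal.ofReal_natCast]
  simp only [poissonMeasure, lintegral_sum_measure, lintegral_smul_measure, lintegral_dirac,
    smul_eq_mul, hterm]
  rw [← ENNReal.ofReal_tsum_of_nonneg (fun n => by positivity) hsum.summable, hsum.tsum_eq,
    ENNReal.ofReal_coe_nnreal]

theorem coe_pointCount_eq_tsum {Ω : Type*} (τ : ℕ → Ω → ℝ) (A : Set ℝ) (ω : Ω) :
    (pointCount τ A ω : ℝ≥0∞) = ∑' i, A.indicator 1 (τ i ω) := by
  rw [pointCount, ← ENNReal.tsum_set_one, tsum_subtype _ (fun _ => (1 : ℝ≥0∞))]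
  rfl

theorem hasSum_indicator_const_comp {Ω : Type*} {τ : ℕ → Ω → ℝ} {A : Set ℝ} {ω : Ω}
    (h : pointCount τ A ω ≠ ⊤) (c : ℝ) :
    HasSum (fun i => A.indicator (fun _ => c) (τ i ω)) (c * (pointCount τ A ω).toNat) := by
  have hfin : {i | τ i ω ∈ A}.Finite := Set.encard_ne_top_iff.1 h
  have hsum := hasSum_sum_of_ne_finset_zero (s := hfin.toFinset) (L := .unconditional ℕ)
    (f := fun i => A.indicator (fun _ => c) (τ i ω))
    fun i hi => indicator_of_notMem (fun hA : τ i ω ∈ A => hi (hfin.mem_toFinset.2 hA)) _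
  rwa [Finset.sum_congr rfl fun i hi => indicator_of_mem (s := A) (hfin.mem_toFinset.1 hi) _,
    Finset.sum_const, nsmul_eq_mul, mul_comm,
    ← ENat.toNat_natCast hfin.toFinset.card, ← hfin.encard_eq_coe_toFinset_card] at hsum

variable {Ω : Type*} [MeasurableSpace Ω] {P : Measure Ω} {τ : ℕ → Ω → ℝ} {ν : Measure ℝ}

theorem measurable_pointCount (hτ : ∀ i, Measurable (τ i)) {A : Set ℝ} (hA : MeasurableSet A) :
    Measurable (pointCount τ A) := by
  have hcoe : Measurable fun ω => (pointCount τ A ω : ℝ≥0∞) := by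
    simp_rw [coe_pointCount_eq_tsum]
    exact Measurable.tsum fun i => (measurable_one.indicator hA).comp (hτ i)
  refine measurable_to_countable' fun n => ?_
  convert hcoe (measurableSet_singleton (n : ℝ≥0∞)) using 1
  ext ω
  simp

namespace IsPoissonPointProcess

theorem measurable_toNat_pointCount (h : IsPoissonPointProcess τ ν P) {A : Set ℝ}
    (hA : MeasurableSet A) : Measurable fun ω => (pointCount τ A ω).toNat :=
  Measurable.of_discrete.comp (measurable_pointCount h.measurable hA)

theorem iIndepFun_pointCount {ι : Type*} [Finite ι] (h : IsPoissonPointProcess τ ν P)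
    {A : ι → Set ℝ} (hA : ∀ j, MeasurableSet (A j))
    (hd : Pairwise fun j k => Disjoint (A j) (A k)) :
    iIndepFun (fun j ω => pointCount τ (A j) ω) P := by
  have e := Finite.equivFin ι
  simpa using (h.count_indep _ (fun k => A (e.symm k)) (fun k => hA _)
    (hd.comp_of_injective e.symm.injective)).precomp e.injective

variable [IsProbabilityMeasure P]

theorem ae_pointCount_ne_top (h : IsPoissonPointProcess τ ν P)
    {A : Set ℝ} (hA : MeasurableSet A) (hνA : ν A ≠ ⊤) : ∀ᵐ ω ∂P, pointCount τ A ω ≠ ⊤ := by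
  have hm (k : ℕ) : MeasurableSet {ω | pointCount τ A ω = k} :=
    measurable_pointCount h.measurable hA (measurableSet_singleton _)
  have hd : Pairwise fun j k : ℕ =>
      Disjoint {ω | pointCount τ A ω = j} {ω | pointCount τ A ω = k} := fun j k hjk =>
    disjoint_left.2 fun ω (hj : _ = _) (hk : _ = _) => hjk (by exact_mod_cast hj.symm.trans hk)
  have hU : {ω | pointCount τ A ω ≠ ⊤} = ⋃ k : ℕ, {ω | pointCount τ A ω = k} := by
    ext ω
    simp [ENat.ne_top_iff_exists, eq_comm]
  have hone : P {ω | pointCount τ A ω ≠ ⊤} = 1 := by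
    rw [hU, measure_iUnion hd hm, tsum_congr (h.count_law A hA hνA),
      ← measure_iUnion (fun _ _ => disjoint_singleton.2) fun _ => measurableSet_singleton _,
      iUnion_of_singleton, measure_univ]
  rwa [ae_iff_measure_eq, measure_univ]
  exact hU ▸ (MeasurableSet.iUnion hm).nullMeasurableSet

theorem map_toNat_pointCount (h : IsPoissonPointProcess τ ν P)
    {A : Set ℝ} (hA : MeasurableSet A) (hνA : ν A ≠ ⊤) :
    P.map (fun ω => (pointCount τ A ω).toNat) = poissonMeasure (ν A).toNNReal := by
  refine Measure.ext_of_singleton fun k => ?_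
  rw [Measure.map_apply (h.measurable_toNat_pointCount hA) (measurableSet_singleton _),
    ← h.count_law A hA hνA k]
  refine measure_congr ?_
  filter_upwards [h.ae_pointCount_ne_top hA hνA] with ω hω
  refine propext (?_ : (pointCount τ A ω).toNat = k ↔ pointCount τ A ω = k)
  lift pointCount τ A ω to ℕ using hω with n
  simp

theorem lintegral_pointCount (h : IsPoissonPointProcess τ ν P)
    {A : Set ℝ} (hA : MeasurableSet A) (hνA : ν A ≠ ⊤) :
    ∫⁻ ω, (pointCount τ A ω : ℝ≥0∞) ∂P = ν A := by
  have htoNat : ∀ᵐ ω ∂P, (pointCount τ A ω : ℝ≥0∞) = ((pointCount τ A ω).toNat : ℕ) := by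
    filter_upwards [h.ae_pointCount_ne_top hA hνA] with ω hω
    lift pointCount τ A ω to ℕ using hω with n
    simp
  rw [lintegral_congr_ae htoNat, ← lintegral_map (f := fun k : ℕ => (k : ℝ≥0∞)) .of_discrete
    (h.measurable_toNat_pointCount hA), h.map_toNat_pointCount hA hνA,
    lintegral_natCast_poissonMeasure, ENNReal.coe_toNNReal hνA]

theorem integral_cexp_mul_pointCount (h : IsPoissonPointProcess τ ν P)
    {A : Set ℝ} (hA : MeasurableSet A) (hνA : ν A ≠ ⊤) (c : ℝ) :
    ∫ ω, cexp (I * (c * (pointCount τ A ω).toNat : ℝ)) ∂P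
      = cexp (ν.real A * (cexp (I * c) - 1)) := by
  have hchar := charFun_map_cast_poissonMeasure (ν A).toNNReal c
  rw [charFun_apply, integral_map .of_discrete (by fun_prop), ← h.map_toNat_pointCount hA hνA,
    integral_map (h.measurable_toNat_pointCount hA).aemeasurable .of_discrete] at hchar
  rw [mul_comm I (c : ℂ)]
  refine (integral_congr_ae (Eventually.of_forall fun ω => ?_)).trans hchar
  simp [mul_comm]

theorem integral_cexp_sum_mul_pointCount {ι : Type*} [Fintype ι] (h : IsPoissonPointProcess τ ν P)
    {A : ι → Set ℝ} (hA : ∀ j, MeasurableSet (A j)) (hνA : ∀ j, ν (A j) ≠ ⊤)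
    (hd : Pairwise fun j k => Disjoint (A j) (A k)) (c : ι → ℝ) :
    ∫ ω, cexp (I * (∑ j, c j * (pointCount τ (A j) ω).toNat : ℝ)) ∂P
      = cexp (∑ j, ν.real (A j) * (cexp (I * c j) - 1)) := by
  calc ∫ ω, cexp (I * (∑ j, c j * (pointCount τ (A j) ω).toNat : ℝ)) ∂P
      = ∫ ω, ∏ j, cexp (I * (c j * (pointCount τ (A j) ω).toNat : ℝ)) ∂P := by
        simp_rw [← Complex.exp_sum, Complex.ofReal_sum, Finset.mul_sum]
    _ = ∏ j, ∫ ω, cexp (I * (c j * (pointCount τ (A j) ω).toNat : ℝ)) ∂P :=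
        (h.iIndepFun_pointCount hA hd).integral_fun_prod_comp
          (f := fun j n => cexp (I * (c j * n.toNat : ℝ)))
          (fun j => (measurable_pointCount h.measurable (hA j)).aemeasurable)
          fun j => .of_discrete
    _ = cexp (∑ j, ν.real (A j) * (cexp (I * c j) - 1)) := by
        simp_rw [Complex.exp_sum, h.integral_cexp_mul_pointCount (hA _) (hνA _)]

theorem integral_cexp_tsum_simpleFunc (h : IsPoissonPointProcess τ ν P) {f : SimpleFunc ℝ ℝ}
    (hf : Integrable f ν) :
    ∫ ω, cexp (I * (∑' i, f (τ i ω) : ℝ)) ∂P = cexp (∫ s, (cexp (I * f s) - 1) ∂ν) := by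
  classical
  let S : Finset ℝ := {y ∈ f.range | y ≠ 0}
  let A : S → Set ℝ := fun y => f ⁻¹' {y.1}
  have hA (y : S) : MeasurableSet (A y) := f.measurableSet_preimage _
  have hνA (y : S) : ν (A y) ≠ ⊤ :=
    (SimpleFunc.integrable_iff.1 hf y (Finset.mem_filter.1 y.2).2).ne
  have hd : Pairwise fun y z => Disjoint (A y) (A z) := fun y z hyz =>
    Disjoint.preimage _ (disjoint_singleton.2 fun h => hyz (Subtype.ext h))
  have hrep {E : Type} [AddCommMonoid E] (φ : ℝ → E) (hφ : φ 0 = 0) (x : ℝ) :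
      φ (f x) = ∑ y : S, (A y).indicator (fun _ => φ y) x := by
    rw [Finset.sum_coe_sort S fun y => (f ⁻¹' {y}).indicator (fun _ => φ y) x]
    by_cases hx : f x = 0 <;> simp [indicator_apply, S, hx, hφ]
  have hsum : ∀ᵐ ω ∂P, ∑' i, f (τ i ω) = ∑ y : S, y.1 * (pointCount τ (A y) ω).toNat := by
    filter_upwards [ae_all_iff.2 fun y => h.ae_pointCount_ne_top (hA y) (hνA y)] with ω hω
    rw [← (hasSum_sum fun y _ => hasSum_indicator_const_comp (hω y) y).tsum_eq]
    exact tsum_congr fun i => hrep id rfl _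
  rw [integral_congr_ae (hsum.mono fun ω hω => by rw [hω]),
    h.integral_cexp_sum_mul_pointCount hA hνA hd]
  simp_rw [hrep (fun x => cexp (I * x) - 1) (by simp)]
  rw [integral_finsetSum _ fun y _ =>
    (integrable_indicator_iff (hA y)).2 (integrableOn_const (hνA y))]
  simp_rw [integral_indicator (hA _), setIntegral_const, Complex.real_smul]

variable [SigmaFinite ν]

theorem sum_map_eq (h : IsPoissonPointProcess τ ν P) :
    Measure.sum (fun i => P.map (τ i)) = ν := by
  rw [Measure.ext_iff_of_iUnion_eq_univ (iUnion_spanningSets ν)]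
  refine fun n => Measure.ext fun B hB => ?_
  rw [Measure.restrict_apply hB, Measure.restrict_apply hB]
  set A := B ∩ spanningSets ν n
  have hA : MeasurableSet A := hB.inter (measurableSet_spanningSets ν n)
  have hνA : ν A ≠ ⊤ :=
    ((measure_mono inter_subset_right).trans_lt (measure_spanningSets_lt_top ν n)).ne
  rw [← h.lintegral_pointCount hA hνA, Measure.sum_apply _ hA]
  simp_rw [coe_pointCount_eq_tsum]
  rw [lintegral_tsum (f := fun i ω => A.indicator 1 (τ i ω)) fun i =>
    ((measurable_one.indicator hA).comp (h.measurable i)).aemeasurable]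
  refine tsum_congr fun i => ?_
  rw [Measure.map_apply (h.measurable i) hA, ← lintegral_indicator_one (h.measurable i hA)]
  rfl

theorem map_absolutelyContinuous (h : IsPoissonPointProcess τ ν P) (i : ℕ) : P.map (τ i) ≪ ν :=
  ((Measure.le_sum _ i).trans_eq h.sum_map_eq).absolutelyContinuous

theorem lintegral_tsum_comp (h : IsPoissonPointProcess τ ν P) {f : ℝ → ℝ≥0∞}
    (hf : AEMeasurable f ν) : ∫⁻ ω, ∑' i, f (τ i ω) ∂P = ∫⁻ s, f s ∂ν := by
  have hfi (i : ℕ) : AEMeasurable f (P.map (τ i)) := hf.mono_ac (h.map_absolutelyContinuous i)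
  rw [lintegral_tsum (f := fun i ω => f (τ i ω)) fun i => (hfi i).comp_measurable (h.measurable i)]
  conv_rhs => rw [← h.sum_map_eq, lintegral_sum_measure]
  exact tsum_congr fun i => (lintegral_map' (hfi i) (h.measurable i).aemeasurable).symm

section Integrable

variable {E : Type*} [NormedAddCommGroup E] {f : ℝ → E}

theorem aestronglyMeasurable_comp (h : IsPoissonPointProcess τ ν P)
    (hf : AEStronglyMeasurable f ν) (i : ℕ) : AEStronglyMeasurable (fun ω => f (τ i ω)) P :=
  (hf.mono_ac (h.map_absolutelyContinuous i)).comp_measurable (h.measurable i)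

theorem ae_summable_norm_comp (h : IsPoissonPointProcess τ ν P) (hf : Integrable f ν) :
    ∀ᵐ ω ∂P, Summable fun i => ‖f (τ i ω)‖ := by
  have hfin : ∫⁻ ω, ∑' i, ‖f (τ i ω)‖ₑ ∂P ≠ ⊤ := by
    rw [h.lintegral_tsum_comp hf.1.enorm]
    exact hf.2.ne
  filter_upwards [ae_lt_top' (AEMeasurable.tsum fun i =>
    (h.aestronglyMeasurable_comp hf.1 i).enorm) hfin] with ω hω
  simpa using ENNReal.summable_toReal hω.ne

theorem integral_tsum_comp [NormedSpace ℝ E] (h : IsPoissonPointProcess τ ν P)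
    (hf : Integrable f ν) : ∫ ω, ∑' i, f (τ i ω) ∂P = ∫ s, f s ∂ν := by
  have hfm := h.aestronglyMeasurable_comp hf.1
  rw [integral_tsum hfm]
  · conv_rhs => rw [← h.sum_map_eq, integral_sum_measure (by rwa [h.sum_map_eq])]
    exact tsum_congr fun i => (integral_map (h.measurable i).aemeasurable
      (hf.1.mono_ac (h.map_absolutelyContinuous i))).symm
  · rw [← lintegral_tsum fun i => (hfm i).enorm, h.lintegral_tsum_comp hf.1.enorm]
    exact hf.2.ne

variable [CompleteSpace E]

theorem integrable_tsum_comp (h : IsPoissonPointProcess τ ν P) (hf : Integrable f ν) :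
    Integrable (fun ω => ∑' i, f (τ i ω)) P := by
  refine ⟨aestronglyMeasurable_of_tendsto_ae atTop
    (f := fun (n : ℕ) ω => ∑ i ∈ Finset.range n, f (τ i ω))
    (fun n => Finset.aestronglyMeasurable_fun_sum _ fun i _ =>
      h.aestronglyMeasurable_comp hf.1 i) ?_, ?_⟩
  · filter_upwards [h.ae_summable_norm_comp hf] with ω hω
    exact hω.of_norm.hasSum.tendsto_sum_nat
  · refine (lintegral_mono fun ω => enorm_tsum_le_tsum_enorm).trans_lt ?_
    rw [h.lintegral_tsum_comp hf.1.enorm]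
    exact hf.2

theorem integral_norm_tsum_comp_le (h : IsPoissonPointProcess τ ν P) (hf : Integrable f ν) :
    ∫ ω, ‖∑' i, f (τ i ω)‖ ∂P ≤ ∫ s, ‖f s‖ ∂ν := by
  rw [← h.integral_tsum_comp hf.norm]
  refine integral_mono_ae (h.integrable_tsum_comp hf).norm (h.integrable_tsum_comp hf.norm) ?_
  filter_upwards [h.ae_summable_norm_comp hf] with ω hω using norm_tsum_le_tsum_norm hω

end Integrable

section CharacteristicFunctional

variable {f k : ℝ → ℝ}

theorem integrable_cexp_tsum_comp (h : IsPoissonPointProcess τ ν P) (hf : Integrable f ν) :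
    Integrable (fun ω => cexp (I * (∑' i, f (τ i ω) : ℝ))) P := by
  have hm := (h.integrable_tsum_comp hf).1.aemeasurable
  refine .of_bound (C := 1) (AEMeasurable.aestronglyMeasurable (by fun_prop)) ?_
  exact Eventually.of_forall fun ω => (Complex.norm_exp_I_mul_ofReal _).le

theorem norm_integral_cexp_tsum_sub_le (h : IsPoissonPointProcess τ ν P) (hf : Integrable f ν)
    (hk : Integrable k ν) :
    ‖∫ ω, cexp (I * (∑' i, f (τ i ω) : ℝ)) ∂P - ∫ ω, cexp (I * (∑' i, k (τ i ω) : ℝ)) ∂P‖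
      ≤ ∫ s, ‖f s - k s‖ ∂ν := by
  rw [← integral_sub (h.integrable_cexp_tsum_comp hf) (h.integrable_cexp_tsum_comp hk)]
  refine (norm_integral_le_of_norm_le (h.integrable_tsum_comp (hf.sub hk)).norm ?_).trans
    (h.integral_norm_tsum_comp_le (hf.sub hk))
  filter_upwards [h.ae_summable_norm_comp hf, h.ae_summable_norm_comp hk] with ω hfω hkω
  exact (norm_cexp_I_mul_sub_cexp_I_mul_le _ _).trans_eq
    (by rw [← hfω.of_norm.tsum_sub hkω.of_norm]; rfl)

-- Both sides are `1`-Lipschitz in `f` for the `L¹` distance and they agree on simple functions.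
theorem integral_cexp_tsum_comp (h : IsPoissonPointProcess τ ν P) (hf : Integrable f ν) :
    ∫ ω, cexp (I * (∑' i, f (τ i ω) : ℝ)) ∂P = cexp (∫ s, (cexp (I * f s) - 1) ∂ν) := by
  refine eq_of_forall_dist_le fun δ hδ => ?_
  obtain ⟨k, hk, hki⟩ := (memLp_one_iff_integrable.2 hf).exists_simpleFunc_eLpNorm_sub_lt
    ENNReal.one_ne_top (ENNReal.ofReal_pos.2 (half_pos hδ)).ne'
  rw [memLp_one_iff_integrable] at hki
  have hfk : ∫ s, ‖f s - k s‖ ∂ν ≤ δ / 2 := by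
    rw [integral_norm_eq_lintegral_enorm (f := fun s => f s - k s) (hf.sub hki).1,
      ← eLpNorm_one_eq_lintegral_enorm]
    exact ENNReal.toReal_le_of_le_ofReal (half_pos hδ).le hk.le
  have hL := h.norm_integral_cexp_tsum_sub_le hf hki
  have hR := norm_cexp_integral_sub_le hf hki
  rw [← dist_eq_norm] at hL hR
  rw [h.integral_cexp_tsum_simpleFunc hki] at hL
  linarith [dist_triangle_right (∫ ω, cexp (I * (∑' i, f (τ i ω) : ℝ)) ∂P)
    (cexp (∫ s, (cexp (I * f s) - 1) ∂ν)) (cexp (∫ s, (cexp (I * k s) - 1) ∂ν))]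

end CharacteristicFunctional

end IsPoissonPointProcess

end PoissonPointProcess

section AreaFormula

theorem injOn_of_hasDerivAt_ne_zero {f f' : ℝ → ℝ} {s : Set ℝ} (hs : s.OrdConnected)
    (hf : ∀ t ∈ s, HasDerivAt f (f' t) t) (h0 : ∀ t ∈ s, f' t ≠ 0) : InjOn f s := by
  refine injOn_iff_pairwise_ne.2 fun x hx y hy hxy => ?_
  wlog hlt : x < y generalizing x y
  · exact (this y hy x hx hxy.symm (hxy.lt_or_gt.resolve_left hlt)).symm
  intro hfxy
  have hsub : Icc x y ⊆ s := hs.out hx hy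
  obtain ⟨c, hc, hc0⟩ := exists_hasDerivAt_eq_zero hlt
    (fun t ht => (hf t (hsub ht)).continuousAt.continuousWithinAt) hfxy
    (fun t ht => hf t (hsub (Ioo_subset_Icc_self ht)))
  exact h0 c (hsub (Ioo_subset_Icc_self hc)) hc0

theorem exists_partition_injOn {f f' : ℝ → ℝ} (hf : ∀ t, HasDerivAt f (f' t) t)
    (hf' : Continuous f') : ∃ A : ℕ → Set ℝ, (∀ n, MeasurableSet (A n)) ∧
      Pairwise (Function.onFun Disjoint A) ∧ (∀ n, InjOn f (A n)) ∧
      ⋃ n, A n = {t | f' t ≠ 0} := by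
  set U : Set ℝ := {t | f' t ≠ 0}
  have hU : IsOpen U := isOpen_ne_fun hf' continuous_const
  obtain ⟨q, hq⟩ := exists_surjective_nat ℚ
  let C : ℕ → Set ℝ := fun n => ordConnectedComponent U (q n)
  have hCU (n : ℕ) : C n ⊆ U := ordConnectedComponent_subset
  have hC (n : ℕ) : InjOn f (C n) :=
    injOn_of_hasDerivAt_ne_zero inferInstance (fun t _ => hf t) fun t ht => hCU n ht
  refine ⟨disjointed C, fun n => .disjointed (fun n => OrdConnected.measurableSet inferInstance) n,
    disjoint_disjointed C, fun n => (hC n).mono (disjointed_subset C n), ?_⟩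
  rw [iUnion_disjointed]
  refine (iUnion_subset hCU).antisymm fun t ht => ?_
  obtain ⟨x, hx⟩ := Rat.denseRange_cast.mem_nhds
    (ordConnectedComponent_mem_nhds.2 (hU.mem_nhds ht))
  obtain ⟨n, rfl⟩ := hq x
  exact mem_iUnion.2 ⟨n, mem_ordConnectedComponent_comm.1 hx⟩

theorem volume_image_critical_eq_zero {f f' : ℝ → ℝ} {s : Set ℝ}
    (hf : ∀ t ∈ s, HasDerivWithinAt f (f' t) s t) (h0 : ∀ t ∈ s, f' t = 0) :
    volume (f '' s) = 0 :=
  addHaar_image_eq_zero_of_det_fderivWithin_eq_zero volume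
    (fun t ht => (hf t ht).hasFDerivWithinAt) fun t ht => by simp [h0 t ht]

theorem encard_iUnion_inter_preimage {α β : Type*} {f : α → β} {B : ℕ → Set α}
    (hd : Pairwise (Function.onFun Disjoint B)) (hi : ∀ n, InjOn f (B n)) (y : β) :
    (((⋃ n, B n) ∩ f ⁻¹' {y}).encard : ℝ≥0∞) = ∑' n, (f '' B n).indicator 1 y := by
  let : MeasurableSpace α := ⊤
  rw [← Measure.count_apply .of_discrete, iUnion_inter,
    measure_iUnion (fun i j hij => (hd hij).mono inter_subset_left inter_subset_left)
      fun _ => .of_discrete]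
  refine tsum_congr fun n => ?_
  by_cases hn : y ∈ f '' B n
  · obtain ⟨t, ht, rfl⟩ := hn
    have hsingle : B n ∩ f ⁻¹' {f t} = {t} :=
      Subset.antisymm (fun x hx => hi n hx.1 ht hx.2) (by rintro x rfl; exact ⟨ht, rfl⟩)
    simp [hsingle, mem_image_of_mem f ht]
  · have hempty : B n ∩ f ⁻¹' {y} = ∅ :=
      eq_empty_of_forall_notMem fun x hx => hn ⟨x, hx.1, hx.2⟩
    simp only [hempty, measure_empty, indicator_of_notMem hn]

theorem lintegral_mul_encard_iUnion_inter_preimage {f f' : ℝ → ℝ} {B : ℕ → Set ℝ}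
    (hf : ∀ n, ∀ t ∈ B n, HasDerivWithinAt f (f' t) (B n) t) (hB : ∀ n, MeasurableSet (B n))
    (hd : Pairwise (Function.onFun Disjoint B)) (hi : ∀ n, InjOn f (B n))
    {h : ℝ → ℝ≥0∞} (hh : Measurable h) :
    ∫⁻ α, h α * (((⋃ n, B n) ∩ f ⁻¹' {α}).encard : ℝ≥0∞)
      = ∫⁻ t in ⋃ n, B n, h (f t) * ENNReal.ofReal |f' t| := by
  have himage (n : ℕ) : MeasurableSet (f '' B n) :=
    (hB n).image_of_continuousOn_injOn (fun t ht => (hf n t ht).continuousWithinAt) (hi n)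
  calc ∫⁻ α, h α * (((⋃ n, B n) ∩ f ⁻¹' {α}).encard : ℝ≥0∞)
      = ∫⁻ α, ∑' n, (f '' B n).indicator h α := by
        refine lintegral_congr fun α => ?_
        rw [encard_iUnion_inter_preimage hd hi, ← ENNReal.tsum_mul_left]
        exact tsum_congr fun n => by by_cases hn : α ∈ f '' B n <;> simp [hn]
    _ = ∑' n, ∫⁻ α in f '' B n, h α := by
        rw [lintegral_tsum fun n => (hh.indicator (himage n)).aemeasurable]
        exact tsum_congr fun n => lintegral_indicator (himage n) h
    _ = ∑' n, ∫⁻ t in B n, h (f t) * ENNReal.ofReal |f' t| := by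
        refine tsum_congr fun n => ?_
        rw [lintegral_image_eq_lintegral_abs_deriv_mul (hB n) (hf n) (hi n)]
        simp_rw [mul_comm]
    _ = ∫⁻ t in ⋃ n, B n, h (f t) * ENNReal.ofReal |f' t| := (lintegral_iUnion hB hd _).symm

-- The level sets through critical points are negligible by Sard's theorem.
theorem lintegral_mul_encard_inter_preimage {f f' : ℝ → ℝ} (hf : ∀ t, HasDerivAt f (f' t) t)
    (hf' : Continuous f') {S : Set ℝ} (hS : MeasurableSet S) {h : ℝ → ℝ≥0∞} (hh : Measurable h) :
    ∫⁻ α, h α * ((S ∩ f ⁻¹' {α}).encard : ℝ≥0∞)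
      = ∫⁻ t in S, h (f t) * ENNReal.ofReal |f' t| := by
  obtain ⟨A, hAm, hAd, hAi, hAU⟩ := exists_partition_injOn hf hf'
  have hU : MeasurableSet {t | f' t ≠ 0} := (isOpen_ne_fun hf' continuous_const).measurableSet
  have hnoncritical : ∀ᵐ α : ℝ, S ∩ f ⁻¹' {α} = (⋃ n, A n ∩ S) ∩ f ⁻¹' {α} := by
    have hsard : volume (f '' {t | f' t = 0}) = 0 :=
      volume_image_critical_eq_zero (fun t _ => (hf t).hasDerivWithinAt) fun t ht => ht
    filter_upwards [measure_eq_zero_iff_ae_notMem.1 hsard] with α hα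
    rw [← iUnion_inter, hAU, inter_assoc]
    exact (inter_eq_right.2 fun t ht h0 => hα ⟨t, h0, ht.2⟩).symm
  calc ∫⁻ α, h α * ((S ∩ f ⁻¹' {α}).encard : ℝ≥0∞)
      = ∫⁻ α, h α * (((⋃ n, A n ∩ S) ∩ f ⁻¹' {α}).encard : ℝ≥0∞) :=
        lintegral_congr_ae (hnoncritical.mono fun α hα => by simp only [hα])
    _ = ∫⁻ t in {t | f' t ≠ 0} ∩ S, h (f t) * ENNReal.ofReal |f' t| := by
        rw [lintegral_mul_encard_iUnion_inter_preimage
          (fun _ t _ => (hf t).hasDerivWithinAt) (fun n => (hAm n).inter hS)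
          (fun i j hij => (hAd hij).mono inter_subset_left inter_subset_left)
          (fun n => (hAi n).mono inter_subset_left) hh, ← iUnion_inter, hAU]
    _ = ∫⁻ t in S, h (f t) * ENNReal.ofReal |f' t| := by
        rw [← Measure.restrict_restrict hU]
        refine setLIntegral_eq_of_support_subset fun t ht h0 => ht ?_
        simp [show f' t = 0 from h0]

end AreaFormula

section CrossingMeasurability

variable {Ω : Type*} [MeasurableSpace Ω]

theorem measurableSet_exists_mem_eq_of_isCompact {Y : ℝ → Ω → ℝ} (hYm : ∀ t, Measurable (Y t))
    (hYc : ∀ ω, Continuous fun t => Y t ω) {C : Set ℝ} (hC : IsCompact C) :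
    MeasurableSet {p : ℝ × Ω | ∃ t ∈ C, Y t p.2 = p.1} := by
  obtain ⟨D, hDC, hDcount, hCD⟩ :=
    (TopologicalSpace.IsSeparable.of_separableSpace C).exists_countable_dense_subset
  have heq : {p : ℝ × Ω | ∃ t ∈ C, Y t p.2 = p.1}
      = ⋂ n : ℕ, ⋃ d ∈ D, {p : ℝ × Ω | |Y d p.2 - p.1| < 1 / ((n : ℝ) + 1)} := by
    ext ⟨α, ω⟩
    simp only [mem_ofPred_eq, mem_iInter, mem_iUnion, exists_prop]
    have hcont : Continuous fun t => |Y t ω - α| := ((hYc ω).sub continuous_const).abs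
    constructor
    · rintro ⟨t, ht, htα⟩ n
      obtain ⟨d, hd, hdD⟩ := mem_closure_iff.1 (hCD ht) {x | |Y x ω - α| < 1 / ((n : ℝ) + 1)}
        (isOpen_lt hcont continuous_const)
        (by simp only [mem_ofPred_eq, htα, sub_self, abs_zero]; positivity)
      exact ⟨d, hdD, hd⟩
    · intro happrox
      obtain ⟨d, hd, _⟩ := happrox 0
      obtain ⟨t, ht, hmin⟩ := hC.exists_isMinOn ⟨d, hDC hd⟩ hcont.continuousOn
      refine ⟨t, ht, ?_⟩
      by_contra hne
      obtain ⟨n, hn⟩ := exists_nat_one_div_lt (abs_pos.2 (sub_ne_zero.2 hne))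
      obtain ⟨d, hd, hlt⟩ := happrox n
      exact absurd (hmin (hDC hd)) (not_le.2 (hlt.trans hn))
  rw [heq]
  exact .iInter fun n => .biUnion hDcount fun d _ => by
    have := hYm d
    exact measurableSet_lt (by fun_prop) measurable_const

theorem measurableSet_exists_mem_eq {Y : ℝ → Ω → ℝ} (hYm : ∀ t, Measurable (Y t))
    (hYc : ∀ ω, Continuous fun t => Y t ω) {C : Set ℝ} (hC : IsSigmaCompact C) :
    MeasurableSet {p : ℝ × Ω | ∃ t ∈ C, Y t p.2 = p.1} := by
  obtain ⟨K, hK, rfl⟩ := hC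
  have heq : {p : ℝ × Ω | ∃ t ∈ ⋃ n, K n, Y t p.2 = p.1}
      = ⋃ n, {p : ℝ × Ω | ∃ t ∈ K n, Y t p.2 = p.1} := by
    ext p
    simp only [mem_iUnion, mem_ofPred_eq, ← exists_and_right, exists_comm (α := ℕ)]
  rw [heq]
  exact .iUnion fun n => measurableSet_exists_mem_eq_of_isCompact hYm hYc (hK n)

theorem exists_injOn_floor_of_finite {T : Set ℝ} (hT : T.Finite) :
    ∃ n : ℕ, InjOn (fun t : ℝ => ⌊((n : ℝ) + 1) * t⌋) T := by
  have hseparated (x y : ℝ) (hxy : x ≠ y) :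
      ∀ᶠ n : ℕ in atTop, ⌊((n : ℝ) + 1) * x⌋ ≠ ⌊((n : ℝ) + 1) * y⌋ := by
    have hpos : 0 < |x - y| := abs_pos.2 (sub_ne_zero.2 hxy)
    obtain ⟨m, hm⟩ := exists_nat_gt (1 / |x - y|)
    filter_upwards [eventually_ge_atTop m] with n hn heq
    have hlt := Int.abs_sub_lt_one_of_floor_eq_floor heq
    rw [← mul_sub, abs_mul, abs_of_pos (by positivity : (0 : ℝ) < (n : ℝ) + 1)] at hlt
    rw [div_lt_iff₀ hpos] at hm
    have hmn : (m : ℝ) ≤ n := mod_cast hn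
    nlinarith
  have hall : ∀ᶠ n : ℕ in atTop, ∀ x ∈ T, ∀ y ∈ T, x ≠ y →
      ⌊((n : ℝ) + 1) * x⌋ ≠ ⌊((n : ℝ) + 1) * y⌋ := by
    simp_rw [eventually_all_finite hT, eventually_imp_distrib_left]
    exact fun x _ y _ => hseparated x y
  exact hall.exists.imp fun n hn => injOn_iff_pairwise_ne.2 fun x hx y hy => hn x hx y hy

theorem encard_eq_iSup_encard_floor_image (K : Set ℝ) :
    K.encard = ⨆ n : ℕ, ((fun t : ℝ => ⌊((n : ℝ) + 1) * t⌋) '' K).encard := by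
  refine le_antisymm (ENat.forall_natCast_le_iff_le.1 fun m hm => ?_)
    (iSup_le fun n => encard_image_le _ _)
  obtain ⟨T, hTK, hT⟩ := exists_subset_encard_eq hm
  obtain ⟨n, hn⟩ := exists_injOn_floor_of_finite (finite_of_encard_eq_coe hT)
  rw [← hT, ← hn.encard_image]
  exact le_iSup_of_le n (encard_le_encard (image_mono hTK))

theorem measurable_encard_of_countable {α β : Type*} [MeasurableSpace α] [Countable β]
    {K : α → Set β} (hK : ∀ k, MeasurableSet {a | k ∈ K a}) :
    Measurable fun a => ((K a).encard : ℝ≥0∞) := by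
  have heq (a : α) : ((K a).encard : ℝ≥0∞) = ∑' k, {a | k ∈ K a}.indicator 1 a := by
    rw [← ENNReal.tsum_set_one]
    exact tsum_subtype (K a) fun _ => (1 : ℝ≥0∞)
  simp_rw [heq]
  exact .tsum fun k => measurable_one.indicator (hK k)

theorem measurable_crossingNumber {Y : ℝ → Ω → ℝ} (hYm : ∀ t, Measurable (Y t))
    (hYc : ∀ ω, Continuous fun t => Y t ω) (a b : ℝ) :
    Measurable fun p : ℝ × Ω => (crossingNumber (fun t => Y t p.2) a b p.1 : ℝ≥0∞) := by
  have hcell (n : ℕ) (k : ℤ) :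
      IsSigmaCompact (Icc a b ∩ {t : ℝ | ⌊((n : ℝ) + 1) * t⌋ = k}) := by
    have hclosed : IsLocallyClosed {t : ℝ | ⌊((n : ℝ) + 1) * t⌋ = k} := by
      have := (isLocallyClosed_Ico (a := (k : ℝ)) (b := k + 1)).preimage
        (continuous_const_mul ((n : ℝ) + 1))
      rwa [← Int.preimage_floor_singleton] at this
    have := (isClosed_Icc (a := a) (b := b)).isLocallyClosed.inter hclosed
    have := this.locallyCompactSpace
    exact isSigmaCompact_iff_sigmaCompactSpace.2 inferInstance
  simp_rw [crossingNumber, encard_eq_iSup_encard_floor_image, ENat.toENNReal_iSup]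
  refine .iSup fun n => measurable_encard_of_countable fun k => ?_
  convert measurableSet_exists_mem_eq hYm hYc (hcell n k) using 1
  ext p
  simp only [mem_image, mem_ofPred_eq, mem_inter_iff, and_right_comm]

end CrossingMeasurability

section MeanCrossings

variable {Ω : Type*} [MeasurableSpace Ω]

/-- `Y` is a real process with continuously differentiable paths, and `Y'` is its pathwise
derivative. -/
structure HasC1Paths (Y Y' : ℝ → Ω → ℝ) : Prop where
  measurable : ∀ t, Measurable (Y t)
  hasDerivAt : ∀ ω t, HasDerivAt (fun t => Y t ω) (Y' t ω) t
  continuous_deriv : ∀ ω, Continuous fun t => Y' t ω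

namespace HasC1Paths

variable {Y Y' : ℝ → Ω → ℝ}

theorem continuous (h : HasC1Paths Y Y') (ω : Ω) : Continuous fun t => Y t ω :=
  continuous_iff_continuousAt.2 fun t => (h.hasDerivAt ω t).continuousAt

theorem measurable_deriv (h : HasC1Paths Y Y') (t : ℝ) : Measurable (Y' t) := by
  have hlim : Tendsto (fun n : ℕ => (1 / ((n : ℝ) + 1))) atTop (𝓝[≠] 0) :=
    tendsto_nhdsWithin_iff.2 ⟨tendsto_one_div_add_atTop_nhds_zero_nat,
      Eventually.of_forall fun n => (Nat.one_div_pos_of_nat (n := n)).ne'⟩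
  refine measurable_of_tendsto_metrizable (f := fun (n : ℕ) ω =>
    (1 / ((n : ℝ) + 1))⁻¹ • (Y (t + 1 / ((n : ℝ) + 1)) ω - Y t ω)) (fun n => ?_) ?_
  · exact ((h.measurable _).sub (h.measurable t)).const_mul _
  · exact tendsto_pi_nhds.2 fun ω => (h.hasDerivAt ω t).tendsto_slope_zero.comp hlim

theorem measurable_uncurry (h : HasC1Paths Y Y') : Measurable fun p : ℝ × Ω => Y p.1 p.2 :=
  measurable_uncurry_of_continuous_of_measurable h.continuous h.measurable

theorem measurable_uncurry_deriv (h : HasC1Paths Y Y') :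
    Measurable fun p : ℝ × Ω => Y' p.1 p.2 :=
  measurable_uncurry_of_continuous_of_measurable h.continuous_deriv h.measurable_deriv

theorem measurable_ofReal_abs_deriv (h : HasC1Paths Y Y') :
    Measurable fun p : ℝ × Ω => ENNReal.ofReal |Y' p.1 p.2| :=
  (measurable_norm.comp h.measurable_uncurry_deriv).ennreal_ofReal

theorem integrable_cexp_mul_abs_deriv {P : Measure Ω} (hY : HasC1Paths Y Y')
    {a b : ℝ}
    (hint : Integrable (fun p : ℝ × Ω => Y' p.1 p.2) ((volume.restrict (Icc a b)).prod P))
    (u : ℝ) :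
    Integrable (fun p : ℝ × Ω => cexp (I * u * Y p.1 p.2) * (|Y' p.1 p.2| : ℝ))
      ((volume.restrict (Icc a b)).prod P) := by
  have hYm := hY.measurable_uncurry
  have hY'm := hY.measurable_uncurry_deriv
  refine hint.mono (Measurable.aestronglyMeasurable (by fun_prop))
    (Eventually.of_forall fun p => ?_)
  rw [norm_mul, norm_cexp_I_mul_ofReal_mul_ofReal, one_mul, Complex.norm_real,
    Real.norm_eq_abs, Real.norm_eq_abs, abs_abs]

variable {P : Measure Ω} [SFinite P]

theorem measurable_meanCrossings (hY : HasC1Paths Y Y') (a b : ℝ) :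
    Measurable (meanCrossings P Y a b) :=
  (measurable_crossingNumber hY.measurable hY.continuous a b).lintegral_prod_right'

theorem lintegral_mul_meanCrossings (hY : HasC1Paths Y Y') (a b : ℝ) {h : ℝ → ℝ≥0∞}
    (hh : Measurable h) :
    ∫⁻ α, h α * meanCrossings P Y a b α
      = ∫⁻ p : ℝ × Ω, h (Y p.1 p.2) * ENNReal.ofReal |Y' p.1 p.2|
          ∂((volume.restrict (Icc a b)).prod P) := by
  have hcount := measurable_crossingNumber hY.measurable hY.continuous a b
  have hintegrand : Measurable fun p : ℝ × Ω => h (Y p.1 p.2) * ENNReal.ofReal |Y' p.1 p.2| :=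
    (hh.comp hY.measurable_uncurry).mul hY.measurable_ofReal_abs_deriv
  calc ∫⁻ α, h α * meanCrossings P Y a b α
      = ∫⁻ α, (∫⁻ ω, h α * (crossingNumber (fun t => Y t ω) a b α : ℝ≥0∞) ∂P) :=
        lintegral_congr fun α =>
          (lintegral_const_mul _ (hcount.comp measurable_prodMk_left)).symm
    _ = ∫⁻ ω, (∫⁻ α, h α * (crossingNumber (fun t => Y t ω) a b α : ℝ≥0∞)) ∂P :=
        lintegral_lintegral_swap ((hh.comp measurable_fst).mul hcount).aemeasurable
    _ = ∫⁻ ω, (∫⁻ t in Icc a b, h (Y t ω) * ENNReal.ofReal |Y' t ω|) ∂P :=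
        lintegral_congr fun ω => lintegral_mul_encard_inter_preimage (hY.hasDerivAt ω)
          (hY.continuous_deriv ω) measurableSet_Icc hh
    _ = _ := (lintegral_prod_symm _ hintegrand.aemeasurable).symm

theorem withDensity_meanCrossings (hY : HasC1Paths Y Y') (a b : ℝ) :
    volume.withDensity (meanCrossings P Y a b)
      = (((volume.restrict (Icc a b)).prod P).withDensity
          (fun p => ENNReal.ofReal |Y' p.1 p.2|)).map (fun p => Y p.1 p.2) := by
  ext s hs
  rw [Measure.map_apply hY.measurable_uncurry hs, withDensity_apply _ hs,
    withDensity_apply _ (hY.measurable_uncurry hs), ← lintegral_indicator hs,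
    ← lintegral_indicator (hY.measurable_uncurry hs)]
  convert hY.lintegral_mul_meanCrossings (P := P) a b (measurable_one.indicator hs) using 1
  · refine lintegral_congr fun α => ?_
    by_cases hα : α ∈ s <;> simp [hα]
  · refine lintegral_congr fun p => ?_
    by_cases hp : Y p.1 p.2 ∈ s <;> simp [hp]

theorem lintegral_meanCrossings_ne_top (hY : HasC1Paths Y Y') {a b : ℝ}
    (hint : Integrable (fun p : ℝ × Ω => Y' p.1 p.2) ((volume.restrict (Icc a b)).prod P)) :
    ∫⁻ α, meanCrossings P Y a b α ≠ ⊤ := by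
  have hrice := hY.lintegral_mul_meanCrossings (P := P) a b measurable_one
  simp only [Pi.one_apply, one_mul] at hrice
  simpa only [hrice, ← Real.norm_eq_abs, ofReal_norm] using hint.2.ne

theorem ae_meanCrossings_ne_top (hY : HasC1Paths Y Y') {a b : ℝ}
    (hint : Integrable (fun p : ℝ × Ω => Y' p.1 p.2) ((volume.restrict (Icc a b)).prod P)) :
    ∀ᵐ α : ℝ, meanCrossings P Y a b α ≠ ⊤ :=
  (ae_lt_top (hY.measurable_meanCrossings a b)
    (hY.lintegral_meanCrossings_ne_top hint)).mono fun _ h => h.ne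

theorem integrable_toReal_meanCrossings (hY : HasC1Paths Y Y') {a b : ℝ}
    (hint : Integrable (fun p : ℝ × Ω => Y' p.1 p.2) ((volume.restrict (Icc a b)).prod P)) :
    Integrable fun α => (meanCrossings P Y a b α).toReal :=
  integrable_toReal_of_lintegral_ne_top (hY.measurable_meanCrossings a b).aemeasurable
    (hY.lintegral_meanCrossings_ne_top hint)

theorem fourierPlus_meanCrossings (hY : HasC1Paths Y Y') {a b : ℝ}
    (hint : Integrable (fun p : ℝ × Ω => Y' p.1 p.2) ((volume.restrict (Icc a b)).prod P))
    (u : ℝ) :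
    fourierPlus (fun α => (meanCrossings P Y a b α).toReal) u
      = ∫ t in Icc a b, ∫ ω, cexp (I * u * Y t ω) * (|Y' t ω| : ℝ) ∂P := by
  have hfinite : ∀ᵐ α : ℝ, meanCrossings P Y a b α < ⊤ :=
    (hY.ae_meanCrossings_ne_top hint).mono fun _ h => h.lt_top
  have hexp : Measurable fun α : ℝ => cexp (I * u * α) := by fun_prop
  calc fourierPlus (fun α => (meanCrossings P Y a b α).toReal) u
      = ∫ α, cexp (I * u * α) ∂(volume.withDensity (meanCrossings P Y a b)) := by
        rw [integral_withDensity_eq_integral_toReal_smul (hY.measurable_meanCrossings a b) hfinite,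
          fourierPlus]
        simp_rw [Complex.real_smul, mul_comm]
    _ = ∫ p : ℝ × Ω, cexp (I * u * Y p.1 p.2) * (|Y' p.1 p.2| : ℝ)
          ∂((volume.restrict (Icc a b)).prod P) := by
        rw [hY.withDensity_meanCrossings,
          integral_map hY.measurable_uncurry.aemeasurable hexp.aestronglyMeasurable,
          integral_withDensity_eq_integral_toReal_smul
            hY.measurable_ofReal_abs_deriv (Eventually.of_forall fun _ => ENNReal.ofReal_lt_top)]
        simp_rw [Complex.real_smul, ENNReal.toReal_ofReal (abs_nonneg _), mul_comm]
    _ = _ := integral_prod _ (hY.integrable_cexp_mul_abs_deriv hint u)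

end HasC1Paths

end MeanCrossings

section SobolevBound

theorem enorm_le_lintegral_enorm_add_deriv {h h' : ℝ → ℝ} (hh : ∀ t, HasDerivAt h (h' t) t)
    (hh' : Continuous h') {a b x : ℝ} (hab : a + 1 ≤ b) (hx : x ∈ Icc a b) :
    ‖h x‖ₑ ≤ ∫⁻ r in Icc a b, (‖h r‖ₑ + ‖h' r‖ₑ) := by
  have hc : Continuous h := continuous_iff_continuousAt.2 fun t => (hh t).continuousAt
  obtain ⟨y, hy, hmin⟩ := isCompact_Icc.exists_isMinOn ⟨x, hx⟩ hc.norm.continuousOn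
  have hmin_le : ‖h y‖ₑ ≤ ∫⁻ r in Icc a b, ‖h r‖ₑ := by
    calc ‖h y‖ₑ ≤ ‖h y‖ₑ * volume (Icc a b) := by
          refine le_mul_of_one_le_right' ?_
          rw [Real.volume_Icc, ENNReal.one_le_ofReal]
          linarith
      _ = ∫⁻ _ in Icc a b, ‖h y‖ₑ := (setLIntegral_const _ _).symm
      _ ≤ ∫⁻ r in Icc a b, ‖h r‖ₑ :=
          setLIntegral_mono' measurableSet_Icc fun r hr => enorm_le_iff_norm_le.2 (hmin hr)
  have hosc : ‖h x - h y‖ₑ ≤ ∫⁻ r in Icc a b, ‖h' r‖ₑ := by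
    have hsub : uIoc y x ⊆ Icc a b := uIoc_subset_uIcc.trans (ordConnected_Icc.uIcc_subset hy hx)
    rw [← intervalIntegral.integral_eq_sub_of_hasDerivAt (fun t _ => hh t)
        (hh'.intervalIntegrable y x), ← ofReal_norm,
      intervalIntegral.norm_intervalIntegral_eq, ofReal_norm]
    exact (enorm_integral_le_lintegral_enorm _).trans (lintegral_mono_set hsub)
  calc ‖h x‖ₑ = ‖h y + (h x - h y)‖ₑ := by rw [add_sub_cancel]
    _ ≤ ‖h y‖ₑ + ‖h x - h y‖ₑ := enorm_add_le _ _
    _ ≤ (∫⁻ r in Icc a b, ‖h r‖ₑ) + ∫⁻ r in Icc a b, ‖h' r‖ₑ := add_le_add hmin_le hosc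
    _ = ∫⁻ r in Icc a b, (‖h r‖ₑ + ‖h' r‖ₑ) := (lintegral_add_left (by fun_prop) _).symm

theorem lintegral_enorm_add_deriv_ne_top {h h' : ℝ → ℝ} (hi : Integrable h)
    (hi' : Integrable h') : ∫⁻ r, (‖h r‖ₑ + ‖h' r‖ₑ) ≠ ⊤ := by
  rw [lintegral_add_left' hi.aestronglyMeasurable.enorm]
  exact ENNReal.add_ne_top.2 ⟨hi.2.ne, hi'.2.ne⟩

theorem exists_abs_le_of_integrable_deriv {h h' : ℝ → ℝ} (hh : ∀ t, HasDerivAt h (h' t) t)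
    (hh' : Continuous h') (hi : Integrable h) (hi' : Integrable h') :
    ∃ C, 0 ≤ C ∧ ∀ x, |h x| ≤ C := by
  refine ⟨_, ENNReal.toReal_nonneg (a := ∫⁻ r, (‖h r‖ₑ + ‖h' r‖ₑ)), fun x => ?_⟩
  have hle := (enorm_le_lintegral_enorm_add_deriv hh hh' le_rfl
    (left_mem_Icc.2 (le_add_of_nonneg_right (zero_le_one' ℝ)) : x ∈ Icc x (x + 1))).trans
    (setLIntegral_le_lintegral _ _)
  simpa using ENNReal.toReal_mono (lintegral_enorm_add_deriv_ne_top hi hi') hle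

end SobolevBound

section NormalConvergence

/-- The series of real functions `∑ i, f i` converges normally on every bounded set. It suffices
to bound the terms on the balls `ball 0 n`. -/
def LocallyNormallySummable {ι : Type*} (f : ι → ℝ → ℝ) : Prop :=
  ∀ n : ℕ, ∃ u : ι → ℝ, Summable u ∧ ∀ i, ∀ t ∈ Metric.ball 0 (n : ℝ), ‖f i t‖ ≤ u i

namespace LocallyNormallySummable

variable {ι : Type*} {f f' : ι → ℝ → ℝ}

theorem zero : LocallyNormallySummable fun (_ : ι) _ => 0 :=
  fun _ => ⟨0, summable_zero, by simp⟩

theorem exists_bound (hf : LocallyNormallySummable f) (t : ℝ) : ∃ n : ℕ,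
    t ∈ Metric.ball 0 (n : ℝ) ∧
      ∃ u : ι → ℝ, Summable u ∧ ∀ i, ∀ t ∈ Metric.ball 0 (n : ℝ), ‖f i t‖ ≤ u i := by
  obtain ⟨n, hn⟩ := exists_nat_gt ‖t‖
  exact ⟨n, mem_ball_zero_iff.2 hn, hf n⟩

theorem summable (hf : LocallyNormallySummable f) (t : ℝ) : Summable fun i => f i t := by
  obtain ⟨n, ht, u, hu, hbound⟩ := hf.exists_bound t
  exact .of_norm_bounded hu fun i => hbound i t ht

theorem continuous_tsum (hf : LocallyNormallySummable f) (hc : ∀ i, Continuous (f i)) :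
    Continuous fun t => ∑' i, f i t := by
  refine continuous_iff_continuousAt.2 fun t => ?_
  obtain ⟨n, ht, u, hu, hbound⟩ := hf.exists_bound t
  exact (continuousOn_tsum (fun i => (hc i).continuousOn) hu hbound).continuousAt
    (Metric.isOpen_ball.mem_nhds ht)

theorem hasDerivAt_tsum (hf : LocallyNormallySummable f) (hf' : LocallyNormallySummable f')
    (hd : ∀ i t, HasDerivAt (f i) (f' i t) t) (t : ℝ) :
    HasDerivAt (fun t => ∑' i, f i t) (∑' i, f' i t) t := by
  obtain ⟨n, ht, u, hu, hbound⟩ := hf'.exists_bound t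
  exact hasDerivAt_tsum_of_isPreconnected hu Metric.isOpen_ball (convex_ball 0 _).isPreconnected
    (fun i y _ => hd i y) hbound ht (hf.summable t) ht

end LocallyNormallySummable

theorem HasC1Paths.tsum {Ω : Type*} [MeasurableSpace Ω] {f f' : ℕ → ℝ → Ω → ℝ}
    (h : ∀ i, HasC1Paths (f i) (f' i))
    (hf : ∀ ω, LocallyNormallySummable fun i t => f i t ω)
    (hf' : ∀ ω, LocallyNormallySummable fun i t => f' i t ω) :
    HasC1Paths (fun t ω => ∑' i, f i t ω) (fun t ω => ∑' i, f' i t ω) where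
  measurable t := measurable_of_tendsto_metrizable
    (f := fun (n : ℕ) ω => ∑ i ∈ Finset.range n, f i t ω)
    (fun _ => Finset.measurable_fun_sum _ fun i _ => (h i).measurable t)
    (tendsto_pi_nhds.2 fun ω => ((hf ω).summable t).hasSum.tendsto_sum_nat)
  hasDerivAt ω := (hf ω).hasDerivAt_tsum (hf' ω) fun i => (h i).hasDerivAt ω
  continuous_deriv ω := (hf' ω).continuous_tsum fun i => (h i).continuous_deriv ω

end NormalConvergence

namespace KernelAssumption

variable {g : ℝ → ℝ}

theorem hasDerivAt (hg : KernelAssumption g) (t : ℝ) : HasDerivAt g (deriv g t) t :=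
  (hg.contDiff.differentiable two_ne_zero t).hasDerivAt

theorem contDiff_deriv (hg : KernelAssumption g) : ContDiff ℝ 1 (deriv g) :=
  (contDiff_succ_iff_deriv (n := 1)).1 (one_add_one_eq_two (R := WithTop ℕ∞) ▸ hg.contDiff) |>.2.2

theorem hasDerivAt_deriv (hg : KernelAssumption g) (t : ℝ) :
    HasDerivAt (deriv g) (deriv (deriv g) t) t :=
  (hg.contDiff_deriv.differentiable one_ne_zero t).hasDerivAt

theorem continuous_deriv (hg : KernelAssumption g) : Continuous (deriv g) :=
  hg.contDiff_deriv.continuous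

theorem continuous_deriv_deriv (hg : KernelAssumption g) : Continuous (deriv (deriv g)) :=
  hg.contDiff_deriv.continuous_deriv le_rfl

end KernelAssumption

section ShotNoisePaths

variable {Ω : Type*} [MeasurableSpace Ω] {P : Measure Ω} [IsProbabilityMeasure P]
  {τ : ℕ → Ω → ℝ} {lam : ℝ}

instance sigmaFinite_ofReal_smul_volume (c : ℝ) :
    SigmaFinite (ENNReal.ofReal c • (volume : Measure ℝ)) :=
  inferInstanceAs (SigmaFinite (c.toNNReal • (volume : Measure ℝ)))

theorem hasC1Paths_indicator_comp_sub {S : Set Ω} (hS : MeasurableSet S) {σ : Ω → ℝ}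
    (hσ : Measurable σ) {h h' : ℝ → ℝ} (hh : ∀ t, HasDerivAt h (h' t) t) (hh' : Continuous h') :
    HasC1Paths (fun t => S.indicator fun ω => h (t - σ ω))
      (fun t => S.indicator fun ω => h' (t - σ ω)) where
  measurable t := by
    have hm : Measurable h :=
      (continuous_iff_continuousAt.2 fun t => (hh t).continuousAt).measurable
    exact (hm.comp (hσ.const_sub t)).indicator hS
  hasDerivAt ω t := by
    by_cases hω : ω ∈ S
    · simpa only [indicator_of_mem hω] using (hh _).comp_sub_const t _
    · simpa only [indicator_of_notMem hω] using hasDerivAt_const t 0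
  continuous_deriv ω := by
    by_cases hω : ω ∈ S
    · simpa only [indicator_of_mem hω, Function.comp_def]
        using hh'.comp (continuous_sub_right (σ ω))
    · simpa only [indicator_of_notMem hω] using continuous_const

theorem lintegral_lintegral_comp_sub_ne_top {f : ℝ → ℝ≥0∞} (hf : Measurable f)
    (hfin : ∫⁻ r, f r ≠ ⊤) {J : Set ℝ} (hJ : volume J ≠ ⊤) :
    ∫⁻ s, ∫⁻ r in J, f (r - s) ≠ ⊤ := by
  rw [lintegral_lintegral_swap (by fun_prop)]
  simp_rw [lintegral_sub_left_eq_self f, setLIntegral_const]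
  exact ENNReal.mul_ne_top hfin hJ

namespace IsPoissonPointProcess

theorem ae_locallyNormallySummable_comp_sub
    (hτ : IsPoissonPointProcess τ (ENNReal.ofReal lam • volume) P) {h h' : ℝ → ℝ}
    (hh : ∀ t, HasDerivAt h (h' t) t) (hh' : Continuous h') (hi : Integrable h)
    (hi' : Integrable h') :
    ∀ᵐ ω ∂P, LocallyNormallySummable fun i t => h (t - τ i ω) := by
  have hc : Continuous h := continuous_iff_continuousAt.2 fun t => (hh t).continuousAt
  have hfm : Measurable fun r => ‖h r‖ₑ + ‖h' r‖ₑ := by fun_prop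
  refine ae_all_iff.2 fun n => ?_
  set J := Icc (-((n : ℝ) + 1)) (n + 1)
  let F : ℝ → ℝ≥0∞ := fun s => ∫⁻ r in J, (‖h (r - s)‖ₑ + ‖h' (r - s)‖ₑ)
  have hFm : Measurable F := Measurable.lintegral_prod_right'
    (f := fun p : ℝ × ℝ => ‖h (p.2 - p.1)‖ₑ + ‖h' (p.2 - p.1)‖ₑ) (by fun_prop)
  have hFfin : ∫⁻ s, F s ≠ ⊤ := lintegral_lintegral_comp_sub_ne_top hfm
    (lintegral_enorm_add_deriv_ne_top hi hi') measure_Icc_lt_top.ne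
  have hsum : ∫⁻ ω, ∑' i, F (τ i ω) ∂P ≠ ⊤ := by
    rw [hτ.lintegral_tsum_comp hFm.aemeasurable, lintegral_smul_measure, smul_eq_mul]
    exact ENNReal.mul_ne_top ENNReal.ofReal_ne_top hFfin
  filter_upwards [ae_lt_top (Measurable.tsum fun i => hFm.comp (hτ.measurable i)) hsum] with ω hω
  refine ⟨fun i => (F (τ i ω)).toReal, ENNReal.summable_toReal hω.ne, fun i t ht => ?_⟩
  have ht' := abs_lt.1 (mem_ball_zero_iff.1 ht)
  have hle := enorm_le_lintegral_enorm_add_deriv (fun r => (hh _).comp_sub_const r (τ i ω))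
    (hh'.comp (continuous_sub_right _)) (by linarith [n.cast_nonneg (α := ℝ)])
    (show t ∈ J from ⟨by linarith, by linarith⟩)
  simpa using ENNReal.toReal_mono (ENNReal.ne_top_of_tsum_ne_top hω.ne i) hle

theorem exists_hasC1Paths_ae_eq_tsum
    (hτ : IsPoissonPointProcess τ (ENNReal.ofReal lam • volume) P) {g : ℝ → ℝ}
    (hg : KernelAssumption g) : ∃ X X' : ℝ → Ω → ℝ, HasC1Paths X X' ∧
      ∀ᵐ ω ∂P, ∀ t, X t ω = ∑' i, g (t - τ i ω) ∧ X' t ω = ∑' i, deriv g (t - τ i ω) := by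
  have hgood : ∀ᵐ ω ∂P, LocallyNormallySummable (fun i t => g (t - τ i ω)) ∧
      LocallyNormallySummable fun i t => deriv g (t - τ i ω) :=
    (hτ.ae_locallyNormallySummable_comp_sub hg.hasDerivAt hg.continuous_deriv hg.integrable
      hg.integrable_deriv).and (hτ.ae_locallyNormallySummable_comp_sub hg.hasDerivAt_deriv
        hg.continuous_deriv_deriv hg.integrable_deriv hg.integrable_deriv_deriv)
  obtain ⟨S, hS, hSm, hSgood⟩ := hgood.exists_measurable_mem
  refine ⟨fun t ω => ∑' i, S.indicator (fun ω => g (t - τ i ω)) ω,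
    fun t ω => ∑' i, S.indicator (fun ω => deriv g (t - τ i ω)) ω,
    .tsum (fun i => hasC1Paths_indicator_comp_sub hSm (hτ.measurable i) hg.hasDerivAt
      hg.continuous_deriv) (fun ω => ?_) fun ω => ?_, ?_⟩
  · by_cases hω : ω ∈ S
    · simpa only [indicator_of_mem hω] using (hSgood ω hω).1
    · simpa only [indicator_of_notMem hω] using .zero
  · by_cases hω : ω ∈ S
    · simpa only [indicator_of_mem hω] using (hSgood ω hω).2
    · simpa only [indicator_of_notMem hω] using .zero
  · filter_upwards [hS] with ω hω t
    simp only [indicator_of_mem hω, and_self]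

end IsPoissonPointProcess

end ShotNoisePaths

section AbsoluteValueKernel

/-- The Fejér-type kernel `(1 - cos v) / v²`. By scaling, `∫ (1 - cos (v * x)) / v² dv` is the
multiple `∫ fejerKernel` of `|x|`. -/
noncomputable def fejerKernel (v : ℝ) : ℝ := (1 - Real.cos v) / v ^ 2

theorem fejerKernel_nonneg (v : ℝ) : 0 ≤ fejerKernel v :=
  div_nonneg (sub_nonneg.2 (Real.cos_le_one v)) (sq_nonneg v)

theorem fejerKernel_le (v : ℝ) : fejerKernel v ≤ 5 / 2 * (1 + v ^ 2)⁻¹ := by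
  rcases eq_or_ne v 0 with rfl | hv
  · norm_num [fejerKernel]
  have hv2 : 0 < v ^ 2 := by positivity
  rw [fejerKernel, ← div_eq_mul_inv, div_le_div_iff₀ hv2 (by positivity)]
  nlinarith [Real.one_sub_sq_div_two_le_cos (x := v), Real.neg_one_le_cos v]

theorem measurable_fejerKernel : Measurable fejerKernel := by
  unfold fejerKernel
  fun_prop

theorem integrable_fejerKernel : Integrable fejerKernel := by
  refine (integrable_inv_one_add_sq.const_mul (5 / 2)).mono'
    measurable_fejerKernel.aestronglyMeasurable (Eventually.of_forall fun v => ?_)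
  rw [Real.norm_of_nonneg (fejerKernel_nonneg v)]
  exact fejerKernel_le v

theorem integral_fejerKernel_pos : 0 < ∫ v, fejerKernel v := by
  rw [integral_pos_iff_support_of_nonneg fejerKernel_nonneg integrable_fejerKernel]
  have hIoo : 0 < volume (Ioo (0 : ℝ) Real.pi) := by simp [Real.pi_pos]
  refine hIoo.trans_le (measure_mono fun v hv => div_ne_zero ?_ (pow_ne_zero 2 hv.1.ne'))
  have hlt := Real.cos_lt_cos_of_nonneg_of_le_pi le_rfl hv.2.le hv.1
  rw [Real.cos_zero] at hlt
  exact (sub_pos.2 hlt).ne'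

theorem one_sub_cos_mul_div_sq (x v : ℝ) :
    (1 - Real.cos (v * x)) / v ^ 2 = x ^ 2 * fejerKernel (v * x) := by
  rcases eq_or_ne x 0 with rfl | hx
  · simp
  rcases eq_or_ne v 0 with rfl | hv
  · simp [fejerKernel]
  rw [fejerKernel]
  field_simp

theorem one_sub_cos_mul_div_sq_nonneg (x v : ℝ) : 0 ≤ (1 - Real.cos (v * x)) / v ^ 2 :=
  div_nonneg (sub_nonneg.2 (Real.cos_le_one _)) (sq_nonneg v)

theorem integrable_one_sub_cos_mul_div_sq (x : ℝ) :
    Integrable fun v : ℝ => (1 - Real.cos (v * x)) / v ^ 2 := by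
  simp_rw [one_sub_cos_mul_div_sq]
  rcases eq_or_ne x 0 with rfl | hx
  · simp
  exact (integrable_fejerKernel.comp_mul_right' hx).const_mul _

theorem integral_one_sub_cos_mul_div_sq (x : ℝ) :
    ∫ v : ℝ, (1 - Real.cos (v * x)) / v ^ 2 = |x| * ∫ v, fejerKernel v := by
  simp_rw [one_sub_cos_mul_div_sq]
  rcases eq_or_ne x 0 with rfl | hx
  · simp
  rw [integral_const_mul, Measure.integral_comp_mul_right, smul_eq_mul, ← mul_assoc, abs_inv,
    ← sq_abs, sq, mul_assoc |x|, mul_inv_cancel₀ (abs_ne_zero.2 hx), mul_one]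

variable {Ω : Type*} [MeasurableSpace Ω] {P : Measure Ω} {e : Ω → ℂ} {W : Ω → ℝ}

theorem integrable_prod_mul_one_sub_cos_mul_div_sq (he : AEStronglyMeasurable e P)
    (he1 : ∀ ω, ‖e ω‖ ≤ 1) (hW : Integrable W P) :
    Integrable (fun p : Ω × ℝ => e p.1 * ((1 - Real.cos (p.2 * W p.1)) / p.2 ^ 2 : ℝ))
      (P.prod volume) := by
  have : AEMeasurable (fun p : Ω × ℝ => W p.1) (P.prod volume) :=
    hW.aestronglyMeasurable.aemeasurable.comp_fst
  have hm : AEStronglyMeasurable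
      (fun p : Ω × ℝ => e p.1 * ((1 - Real.cos (p.2 * W p.1)) / p.2 ^ 2 : ℝ)) (P.prod volume) :=
    he.comp_fst.mul (AEMeasurable.aestronglyMeasurable (by fun_prop))
  have hsec (ω : Ω) : Integrable fun v : ℝ => e ω * ((1 - Real.cos (v * W ω)) / v ^ 2 : ℝ) :=
    (integrable_one_sub_cos_mul_div_sq (W ω)).ofReal.const_mul _
  rw [integrable_prod_iff hm]
  refine ⟨Eventually.of_forall hsec, (hW.norm.mul_const (∫ v, fejerKernel v)).mono'
    hm.norm.integral_prod_right' (Eventually.of_forall fun ω => ?_)⟩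
  rw [Real.norm_of_nonneg (integral_nonneg fun v => norm_nonneg _), Real.norm_eq_abs,
    ← integral_one_sub_cos_mul_div_sq]
  refine integral_mono (hsec ω).norm (integrable_one_sub_cos_mul_div_sq (W ω)) fun v => ?_
  rw [norm_mul, Complex.norm_of_nonneg (one_sub_cos_mul_div_sq_nonneg _ _)]
  exact mul_le_of_le_one_left (one_sub_cos_mul_div_sq_nonneg _ _) (he1 ω)

theorem integral_fejerKernel_mul_integral_mul_abs [SFinite P] (he : AEStronglyMeasurable e P)
    (he1 : ∀ ω, ‖e ω‖ ≤ 1) (hW : Integrable W P) :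
    ((∫ v, fejerKernel v : ℝ) : ℂ) * ∫ ω, e ω * (|W ω| : ℝ) ∂P
      = ∫ v : ℝ, ∫ ω, e ω * ((1 - Real.cos (v * W ω)) / v ^ 2 : ℝ) ∂P := by
  rw [← integral_integral_swap (integrable_prod_mul_one_sub_cos_mul_div_sq he he1 hW),
    ← integral_const_mul]
  refine integral_congr_ae (Eventually.of_forall fun ω => ?_)
  simp only [integral_const_mul, integral_complex_ofReal, integral_one_sub_cos_mul_div_sq]
  push_cast
  ring

end AbsoluteValueKernel

section GaussianAbsoluteMoment

theorem integral_Ioi_mul_exp_neg_mul_sq {b : ℝ} (hb : 0 < b) :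
    ∫ r : ℝ in Ioi 0, r * Real.exp (-b * r ^ 2) = (2 * b)⁻¹ := by
  have h := integral_mul_cexp_neg_mul_sq (b := b) (by rwa [Complex.ofReal_re])
  rw [← Complex.ofReal_inj, ← integral_complex_ofReal]
  push_cast
  exact h

theorem integral_abs_gaussianReal (σ : ℝ≥0) :
    ∫ x, |x| ∂(gaussianReal 0 σ) = √(2 * σ / Real.pi) := by
  rcases eq_or_ne σ 0 with rfl | hσ
  · simp
  have hpdf (x : ℝ) : gaussianPDFReal 0 σ x • |x|
      = (√(2 * Real.pi * σ))⁻¹ * (|x| * Real.exp (-(2 * σ : ℝ)⁻¹ * |x| ^ 2)) := by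
    rw [gaussianPDFReal, smul_eq_mul, sq_abs, sub_zero, neg_mul, neg_div, div_eq_inv_mul (x ^ 2)]
    ring
  rw [integral_gaussianReal_eq_integral_smul hσ]
  simp_rw [hpdf]
  rw [integral_const_mul,
    integral_comp_abs (f := fun x => x * Real.exp (-(2 * σ : ℝ)⁻¹ * x ^ 2)),
    integral_Ioi_mul_exp_neg_mul_sq (by positivity), eq_comm,
    Real.sqrt_eq_iff_mul_self_eq (by positivity) (by positivity)]
  field_simp
  rw [Real.sq_sqrt (by positivity)]

theorem integral_cos_mul_gaussianReal (σ : ℝ≥0) (v : ℝ) :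
    ∫ x, Real.cos (v * x) ∂(gaussianReal 0 σ) = Real.exp (-(σ * v ^ 2 / 2)) := by
  have hint : Integrable (fun x : ℝ => cexp (v * x * I)) (gaussianReal 0 σ) :=
    (integrable_const (1 : ℝ)).mono' (by fun_prop) (Eventually.of_forall fun x => by
      rw [← Complex.ofReal_mul, Complex.norm_exp_ofReal_mul_I])
  have hchar := congrArg Complex.re (charFun_gaussianReal (μ := 0) (v := σ) v)
  rw [charFun_apply_real, ← RCLike.re_eq_complex_re, ← integral_re hint] at hchar
  simp only [RCLike.re_eq_complex_re, ← Complex.ofReal_mul, Complex.exp_ofReal_mul_I_re] at hchar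
  rw [hchar, ← Complex.exp_ofReal_re]
  congr 2
  push_cast
  ring

theorem integral_one_sub_cos_mul_div_sq_gaussianReal (σ : ℝ≥0) (v : ℝ) :
    ∫ x, (1 - Real.cos (v * x)) / v ^ 2 ∂(gaussianReal 0 σ)
      = (1 - Real.exp (-(σ * v ^ 2 / 2))) / v ^ 2 := by
  have hint : Integrable (fun x : ℝ => Real.cos (v * x)) (gaussianReal 0 σ) :=
    (integrable_const (1 : ℝ)).mono' (by fun_prop)
      (Eventually.of_forall fun x => Real.abs_cos_le_one _)
  rw [integral_div, integral_sub (integrable_const _) hint, integral_cos_mul_gaussianReal,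
    integral_const, probReal_univ, one_smul]

theorem integrable_one_sub_exp_div_sq (σ : ℝ≥0) :
    Integrable fun v : ℝ => (1 - Real.exp (-(σ * v ^ 2 / 2))) / v ^ 2 := by
  have h := (integrable_prod_mul_one_sub_cos_mul_div_sq (P := gaussianReal 0 σ) (e := 1)
    aestronglyMeasurable_const (by simp)
    ((memLp_id_gaussianReal 1).integrable le_rfl)).integral_prod_right.re
  simpa [integral_complex_ofReal, integral_one_sub_cos_mul_div_sq_gaussianReal,
    -Complex.ofReal_div, -Complex.ofReal_sub] using h

theorem integral_fejerKernel_mul_sqrt (σ : ℝ≥0) :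
    (∫ v, fejerKernel v) * √(2 * σ / Real.pi)
      = ∫ v : ℝ, (1 - Real.exp (-(σ * v ^ 2 / 2))) / v ^ 2 := by
  have h := integral_fejerKernel_mul_integral_mul_abs (P := gaussianReal 0 σ) (e := 1) (W := id)
    aestronglyMeasurable_const (by simp) ((memLp_id_gaussianReal 1).integrable le_rfl)
  simp only [Pi.one_apply, one_mul, id_eq, integral_complex_ofReal, integral_abs_gaussianReal,
    integral_one_sub_cos_mul_div_sq_gaussianReal] at h
  exact_mod_cast h

end GaussianAbsoluteMoment

section CompensatedExp

/-- The compensated exponential `e^{ix} - 1 - ix`: its integral against the intensity is the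
logarithm of the characteristic function of a centred Poisson integral. -/
noncomputable def compensatedExp (x : ℝ) : ℂ := cexp (I * x) - 1 - I * x

theorem compensatedExp_re (x : ℝ) : (compensatedExp x).re = Real.cos x - 1 := by
  simp [compensatedExp, mul_comm I, Complex.exp_ofReal_mul_I_re]

theorem norm_compensatedExp_le {x : ℝ} (hx : |x| ≤ 1) : ‖compensatedExp x‖ ≤ x ^ 2 := by
  have hn : ‖I * (x : ℂ)‖ = |x| := by simp
  simpa [compensatedExp] using
    Complex.norm_exp_sub_one_sub_id_le (x := I * x) (hn.trans_le hx)

theorem norm_compensatedExp_add_sq_div_two_le {x : ℝ} (hx : |x| ≤ 1) :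
    ‖compensatedExp x + (x ^ 2 / 2 : ℝ)‖ ≤ |x| ^ 3 := by
  have hn : ‖I * (x : ℂ)‖ = |x| := by simp
  have h := Complex.exp_bound (hn.trans_le hx) (n := 3) (by norm_num)
  have htaylor : compensatedExp x + (x ^ 2 / 2 : ℝ)
      = cexp (I * x) - ∑ m ∈ Finset.range 3, (I * (x : ℂ)) ^ m / (m.factorial : ℂ) := by
    simp only [compensatedExp, Finset.sum_range_succ, Finset.sum_range_zero, Nat.factorial,
      mul_pow, Complex.I_sq]
    push_cast
    ring
  rw [htaylor]
  rw [hn] at h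
  exact h.trans (mul_le_of_le_one_right (by positivity) (by norm_num [Nat.factorial]))

theorem cos_sub_one_le_neg_sq_div_four {x : ℝ} (hx : |x| ≤ 1) :
    Real.cos x - 1 ≤ -(x ^ 2 / 4) := by
  have h := (abs_le.1 (Real.cos_bound hx)).2
  have h4 : |x| ^ 4 ≤ |x| ^ 2 := pow_le_pow_of_le_one (abs_nonneg x) hx (by norm_num)
  rw [sq_abs] at h4
  linarith [sq_nonneg x]

theorem abs_cos_sub_one_le (x : ℝ) : |Real.cos x - 1| ≤ x ^ 2 / 2 := by
  rw [abs_sub_comm, abs_of_nonneg (sub_nonneg.2 (Real.cos_le_one x))]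
  linarith [Real.one_sub_sq_div_two_le_cos (x := x)]

theorem abs_cos_sub_one_add_sq_div_two_le {x : ℝ} (hx : |x| ≤ 1) :
    |Real.cos x - 1 + x ^ 2 / 2| ≤ |x| ^ 3 := by
  have h3 : |x| ^ 4 ≤ |x| ^ 3 := pow_le_pow_of_le_one (abs_nonneg x) hx (by norm_num)
  rw [show Real.cos x - 1 + x ^ 2 / 2 = Real.cos x - (1 - x ^ 2 / 2) by ring]
  linarith [Real.cos_bound hx, pow_nonneg (abs_nonneg x) 3]

theorem abs_sin_sub_self_le {x : ℝ} (hx : |x| ≤ 1) : |Real.sin x - x| ≤ |x| ^ 3 := by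
  have h5 : |x| ^ 5 ≤ |x| ^ 3 := pow_le_pow_of_le_one (abs_nonneg x) hx (by norm_num)
  have h6 : |x ^ 3 / 6| = |x| ^ 3 / 6 := by
    rw [abs_div, abs_pow, abs_of_pos (by norm_num : (0 : ℝ) < 6)]
  rw [show Real.sin x - x = (Real.sin x - (x - x ^ 3 / 6)) - x ^ 3 / 6 by ring]
  linarith [abs_sub (Real.sin x - (x - x ^ 3 / 6)) (x ^ 3 / 6), Real.sin_bound hx,
    pow_nonneg (abs_nonneg x) 3]

theorem cexp_I_mul_ofReal_add (y x : ℝ) :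
    cexp (I * (y + x : ℝ)) = cexp (I * y) * (Real.cos x + I * Real.sin x) := by
  rw [Complex.ofReal_add, mul_add, Complex.exp_add, mul_comm I (x : ℂ), Complex.exp_mul_I,
    Complex.ofReal_cos, Complex.ofReal_sin, mul_comm I (Complex.sin x)]

theorem compensatedExp_even_part (y x : ℝ) :
    (compensatedExp (y + x) + compensatedExp (y - x)) / 2 - compensatedExp y
      = cexp (I * y) * (Real.cos x - 1 : ℝ) := by
  simp only [compensatedExp, sub_eq_add_neg y, cexp_I_mul_ofReal_add, Real.cos_neg, Real.sin_neg]
  push_cast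
  ring

theorem compensatedExp_odd_part (y x : ℝ) :
    (compensatedExp (y + x) - compensatedExp (y - x)) / 2
      = I * (cexp (I * y) * Real.sin x - x) := by
  simp only [compensatedExp, sub_eq_add_neg y, cexp_I_mul_ofReal_add, Real.cos_neg, Real.sin_neg]
  push_cast
  ring

theorem re_compensatedExp_even_part_nonpos {y : ℝ} (hy : |y| ≤ 1) (x : ℝ) :
    ((compensatedExp (y + x) + compensatedExp (y - x)) / 2 - compensatedExp y).re ≤ 0 := by
  rw [compensatedExp_even_part, Complex.re_mul_ofReal, mul_comm I, Complex.exp_ofReal_mul_I_re]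
  exact mul_nonpos_of_nonneg_of_nonpos (Real.cos_pos_of_le_one hy).le
    (sub_nonpos.2 (Real.cos_le_one x))

theorem norm_compensatedExp_even_part_add_le (y : ℝ) {x : ℝ} (hx : |x| ≤ 1) :
    ‖(compensatedExp (y + x) + compensatedExp (y - x)) / 2 - compensatedExp y
      + (x ^ 2 / 2 : ℝ)‖ ≤ |y| * (x ^ 2 / 2) + |x| ^ 3 := by
  have hsplit : cexp (I * y) * (Real.cos x - 1 : ℝ) + (x ^ 2 / 2 : ℝ)
      = (cexp (I * y) - 1) * (Real.cos x - 1 : ℝ) + (Real.cos x - 1 + x ^ 2 / 2 : ℝ) := by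
    push_cast
    ring
  rw [compensatedExp_even_part, hsplit]
  refine (norm_add_le _ _).trans (add_le_add ?_ ?_)
  · rw [norm_mul, Complex.norm_real]
    exact mul_le_mul Real.norm_exp_I_mul_ofReal_sub_one_le (abs_cos_sub_one_le x)
      (norm_nonneg _) (abs_nonneg y)
  · rw [Complex.norm_real]
    exact abs_cos_sub_one_add_sq_div_two_le hx

theorem norm_compensatedExp_odd_part_add_le {y x : ℝ} (hy : |y| ≤ 1) (hx : |x| ≤ 1) :
    ‖(compensatedExp (y + x) - compensatedExp (y - x)) / 2 + (y * x : ℝ)‖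
      ≤ y ^ 2 * |x| + 2 * |x| ^ 3 := by
  have hsplit : I * (cexp (I * y) * Real.sin x - x) + (y * x : ℝ)
      = I * (compensatedExp y * Real.sin x + (1 + I * y) * (Real.sin x - x : ℝ)) := by
    rw [compensatedExp]
    push_cast
    linear_combination (x * y : ℂ) * Complex.I_sq
  have hone : ‖1 + I * (y : ℂ)‖ ≤ 2 := by
    refine (norm_add_le _ _).trans ?_
    rw [norm_one, norm_mul, Complex.norm_I, one_mul, Complex.norm_real, Real.norm_eq_abs]
    linarith
  rw [compensatedExp_odd_part, hsplit, norm_mul, Complex.norm_I, one_mul]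
  refine (norm_add_le _ _).trans (add_le_add ?_ ?_) <;> rw [norm_mul, Complex.norm_real]
  · exact mul_le_mul (norm_compensatedExp_le hy) Real.abs_sin_le_abs (norm_nonneg _)
      (sq_nonneg y)
  · exact mul_le_mul hone (abs_sin_sub_self_le hx) (norm_nonneg _) zero_le_two

end CompensatedExp

section Cumulant

variable {α : Type*} [MeasurableSpace α] {μ : Measure α} {p q : α → ℝ} {M m₀ m₂ : ℝ}

theorem integrable_compensatedExp_comp {f : α → ℝ} (hf : Integrable f μ) :
    Integrable (fun s => compensatedExp (f s)) μ :=
  (integrable_cexp_I_mul_sub_one hf).sub (hf.ofReal.const_mul I)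

/-- The logarithm of the characteristic function at `(u, v)` of the pair of centred Poisson
integrals of `p` and `q` with intensity `μ`. -/
noncomputable def cumulant (p q : α → ℝ) (μ : Measure α) (u v : ℝ) : ℂ :=
  ∫ s, compensatedExp (u * p s + v * q s) ∂μ

/-- Integrable functions `p` and `q`, bounded by `M`, orthogonal in `L²(μ)` and with squared
`L²`-norms `m₀` and `m₂`. For shot noise these are `g` and `g'`, rescaled. -/
structure BoundedOrthogonalPair (p q : α → ℝ) (μ : Measure α) (M m₀ m₂ : ℝ) : Prop where
  integrable_fst : Integrable p μ
  integrable_snd : Integrable q μ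
  pos : 0 < M
  abs_fst_le : ∀ s, |p s| ≤ M
  abs_snd_le : ∀ s, |q s| ≤ M
  orthogonal : ∫ s, p s * q s ∂μ = 0
  integral_sq_fst : ∫ s, p s ^ 2 ∂μ = m₀
  integral_sq_snd : ∫ s, q s ^ 2 ∂μ = m₂

namespace BoundedOrthogonalPair

theorem nonneg_fst (H : BoundedOrthogonalPair p q μ M m₀ m₂) : 0 ≤ m₀ :=
  H.integral_sq_fst ▸ integral_nonneg fun s => sq_nonneg (p s)

theorem nonneg_snd (H : BoundedOrthogonalPair p q μ M m₀ m₂) : 0 ≤ m₂ :=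
  H.integral_sq_snd ▸ integral_nonneg fun s => sq_nonneg (q s)

theorem integrable_sq_fst (H : BoundedOrthogonalPair p q μ M m₀ m₂) :
    Integrable (fun s => p s ^ 2) μ := by
  simp_rw [sq]
  exact H.integrable_fst.mul_bdd H.integrable_fst.1 (Eventually.of_forall H.abs_fst_le)

theorem integrable_sq_snd (H : BoundedOrthogonalPair p q μ M m₀ m₂) :
    Integrable (fun s => q s ^ 2) μ := by
  simp_rw [sq]
  exact H.integrable_snd.mul_bdd H.integrable_snd.1 (Eventually.of_forall H.abs_snd_le)

theorem integrable_mul (H : BoundedOrthogonalPair p q μ M m₀ m₂) :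
    Integrable (fun s => p s * q s) μ :=
  H.integrable_fst.mul_bdd H.integrable_snd.1 (Eventually.of_forall H.abs_snd_le)

theorem integrable_combination (H : BoundedOrthogonalPair p q μ M m₀ m₂) (u v : ℝ) :
    Integrable (fun s => u * p s + v * q s) μ :=
  (H.integrable_fst.const_mul u).add (H.integrable_snd.const_mul v)

theorem integrable_sq_combination (H : BoundedOrthogonalPair p q μ M m₀ m₂) (u v : ℝ) :
    Integrable (fun s => (u * p s + v * q s) ^ 2) μ := by
  refine (((H.integrable_sq_fst.const_mul (u ^ 2)).add (H.integrable_sq_snd.const_mul (v ^ 2))).add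
    (H.integrable_mul.const_mul (2 * u * v))).congr (Eventually.of_forall fun s => ?_)
  simp only [Pi.add_apply]
  ring

theorem integral_sq_combination (H : BoundedOrthogonalPair p q μ M m₀ m₂) (u v : ℝ) :
    ∫ s, (u * p s + v * q s) ^ 2 ∂μ = m₀ * u ^ 2 + m₂ * v ^ 2 := by
  have hsq (s : α) : (u * p s + v * q s) ^ 2
      = u ^ 2 * p s ^ 2 + v ^ 2 * q s ^ 2 + 2 * u * v * (p s * q s) := by ring
  have hpq : Integrable (fun s => u ^ 2 * p s ^ 2 + v ^ 2 * q s ^ 2) μ :=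
    (H.integrable_sq_fst.const_mul _).add (H.integrable_sq_snd.const_mul _)
  simp_rw [hsq]
  rw [integral_add hpq (H.integrable_mul.const_mul _),
    integral_add (H.integrable_sq_fst.const_mul _) (H.integrable_sq_snd.const_mul _)]
  simp only [integral_const_mul, H.orthogonal, H.integral_sq_fst, H.integral_sq_snd]
  ring

theorem norm_integral_le (H : BoundedOrthogonalPair p q μ M m₀ m₂) {φ : α → ℂ} {c₀ c₂ : ℝ}
    (hφ : ∀ s, ‖φ s‖ ≤ c₀ * p s ^ 2 + c₂ * q s ^ 2) : ‖∫ s, φ s ∂μ‖ ≤ c₀ * m₀ + c₂ * m₂ := by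
  refine (norm_integral_le_of_norm_le ((H.integrable_sq_fst.const_mul c₀).add
    (H.integrable_sq_snd.const_mul c₂)) (Eventually.of_forall hφ)).trans_eq ?_
  rw [integral_add' (H.integrable_sq_fst.const_mul c₀) (H.integrable_sq_snd.const_mul c₂),
    integral_const_mul, integral_const_mul, H.integral_sq_fst, H.integral_sq_snd]

theorem integrable_cumulant_integrand (H : BoundedOrthogonalPair p q μ M m₀ m₂) (u v : ℝ) :
    Integrable (fun s => compensatedExp (u * p s + v * q s)) μ :=
  integrable_compensatedExp_comp (H.integrable_combination u v)

theorem abs_const_mul_fst_le (H : BoundedOrthogonalPair p q μ M m₀ m₂) {u : ℝ}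
    (hu : |u| * (2 * M) ≤ 1) (s : α) : |u * p s| ≤ 1 / 2 := by
  rw [abs_mul]
  linarith [mul_le_mul_of_nonneg_left (H.abs_fst_le s) (abs_nonneg u)]

theorem abs_const_mul_snd_le (H : BoundedOrthogonalPair p q μ M m₀ m₂) {v : ℝ}
    (hv : |v| * (2 * M) ≤ 1) (s : α) : |v * q s| ≤ 1 / 2 := by
  rw [abs_mul]
  linarith [mul_le_mul_of_nonneg_left (H.abs_snd_le s) (abs_nonneg v)]

theorem abs_combination_le_one (H : BoundedOrthogonalPair p q μ M m₀ m₂) {u v : ℝ}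
    (hu : |u| * (2 * M) ≤ 1) (hv : |v| * (2 * M) ≤ 1) (s : α) : |u * p s + v * q s| ≤ 1 :=
  (abs_add_le _ _).trans (by linarith [H.abs_const_mul_fst_le hu s, H.abs_const_mul_snd_le hv s])

theorem abs_const_mul_fst_pow_three_le (H : BoundedOrthogonalPair p q μ M m₀ m₂) (u : ℝ) (s : α) :
    |u * p s| ^ 3 ≤ M * |u| ^ 3 * p s ^ 2 := by
  calc |u * p s| ^ 3 = |u| ^ 3 * |p s| ^ 2 * |p s| := by rw [abs_mul]; ring
    _ ≤ |u| ^ 3 * |p s| ^ 2 * M := by gcongr; exact H.abs_fst_le s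
    _ = M * |u| ^ 3 * p s ^ 2 := by rw [sq_abs]; ring

theorem abs_const_mul_snd_pow_three_le (H : BoundedOrthogonalPair p q μ M m₀ m₂) (v : ℝ) (s : α) :
    |v * q s| ^ 3 ≤ M * |v| ^ 3 * q s ^ 2 := by
  calc |v * q s| ^ 3 = |v| ^ 3 * |q s| ^ 2 * |q s| := by rw [abs_mul]; ring
    _ ≤ |v| ^ 3 * |q s| ^ 2 * M := by gcongr; exact H.abs_snd_le s
    _ = M * |v| ^ 3 * q s ^ 2 := by rw [sq_abs]; ring

theorem abs_combination_pow_three_le (H : BoundedOrthogonalPair p q μ M m₀ m₂) (u v : ℝ) (s : α) :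
    |u * p s + v * q s| ^ 3 ≤ 4 * M * |u| ^ 3 * p s ^ 2 + 4 * M * |v| ^ 3 * q s ^ 2 := by
  calc |u * p s + v * q s| ^ 3 ≤ (|u * p s| + |v * q s|) ^ 3 := by gcongr; exact abs_add_le _ _
    _ ≤ 2 ^ (3 - 1) * (|u * p s| ^ 3 + |v * q s| ^ 3) :=
      add_pow_le (abs_nonneg _) (abs_nonneg _) 3
    _ ≤ 4 * M * |u| ^ 3 * p s ^ 2 + 4 * M * |v| ^ 3 * q s ^ 2 := by
      norm_num only
      linarith [H.abs_const_mul_fst_pow_three_le u s, H.abs_const_mul_snd_pow_three_le v s]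

theorem norm_cumulant_add_le (H : BoundedOrthogonalPair p q μ M m₀ m₂) {u v : ℝ}
    (hu : |u| * (2 * M) ≤ 1) (hv : |v| * (2 * M) ≤ 1) :
    ‖cumulant p q μ u v + ((m₀ * u ^ 2 + m₂ * v ^ 2) / 2 : ℝ)‖
      ≤ 4 * M * (m₀ * |u| ^ 3 + m₂ * |v| ^ 3) := by
  have hsq : Integrable (fun s => (((u * p s + v * q s) ^ 2 / 2 : ℝ) : ℂ)) μ :=
    ((H.integrable_sq_combination u v).div_const 2).ofReal
  rw [cumulant, ← H.integral_sq_combination, ← integral_div, ← integral_complex_ofReal,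
    ← integral_add (H.integrable_cumulant_integrand u v) hsq]
  refine (H.norm_integral_le (c₀ := 4 * M * |u| ^ 3) (c₂ := 4 * M * |v| ^ 3)
    fun s => ?_).trans_eq (by ring)
  exact (norm_compensatedExp_add_sq_div_two_le (H.abs_combination_le_one hu hv s)).trans
    (H.abs_combination_pow_three_le u v s)

theorem re_cumulant (H : BoundedOrthogonalPair p q μ M m₀ m₂) (u v : ℝ) :
    (cumulant p q μ u v).re = ∫ s, (Real.cos (u * p s + v * q s) - 1) ∂μ := by
  simp_rw [← compensatedExp_re, cumulant, ← RCLike.re_eq_complex_re]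
  exact (integral_re (H.integrable_cumulant_integrand u v)).symm

theorem re_cumulant_nonpos (H : BoundedOrthogonalPair p q μ M m₀ m₂) (u v : ℝ) :
    (cumulant p q μ u v).re ≤ 0 := by
  rw [H.re_cumulant]
  exact integral_nonpos fun s => sub_nonpos.2 (Real.cos_le_one _)

theorem norm_cexp_cumulant_le_one (H : BoundedOrthogonalPair p q μ M m₀ m₂) (u v : ℝ) :
    ‖cexp (cumulant p q μ u v)‖ ≤ 1 := by
  rw [Complex.norm_exp]
  exact Real.exp_le_one_iff.2 (H.re_cumulant_nonpos u v)

theorem re_cumulant_le (H : BoundedOrthogonalPair p q μ M m₀ m₂) {u v : ℝ}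
    (hu : |u| * (2 * M) ≤ 1) (hv : |v| * (2 * M) ≤ 1) :
    (cumulant p q μ u v).re ≤ -((m₀ * u ^ 2 + m₂ * v ^ 2) / 4) := by
  rw [H.re_cumulant, ← H.integral_sq_combination, ← integral_div, ← integral_neg]
  refine integral_mono ?_ ((H.integrable_sq_combination u v).div_const 4).neg fun s =>
    cos_sub_one_le_neg_sq_div_four (H.abs_combination_le_one hu hv s)
  simpa only [RCLike.re_eq_complex_re, compensatedExp_re] using
    (H.integrable_cumulant_integrand u v).re

theorem integrable_cumulant_integrand_neg (H : BoundedOrthogonalPair p q μ M m₀ m₂) (u v : ℝ) :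
    Integrable (fun s => compensatedExp (u * p s - v * q s)) μ := by
  simpa only [neg_mul, ← sub_eq_add_neg] using H.integrable_cumulant_integrand u (-v)

theorem integrable_cumulant_even_integrand (H : BoundedOrthogonalPair p q μ M m₀ m₂) (u v : ℝ) :
    Integrable (fun s => (compensatedExp (u * p s + v * q s) + compensatedExp (u * p s - v * q s))
      / 2 - compensatedExp (u * p s)) μ :=
  (((H.integrable_cumulant_integrand u v).add (H.integrable_cumulant_integrand_neg u v)).div_const
    2).sub (integrable_compensatedExp_comp (H.integrable_fst.const_mul u))

theorem cumulant_even_part (H : BoundedOrthogonalPair p q μ M m₀ m₂) (u v : ℝ) :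
    (cumulant p q μ u v + cumulant p q μ u (-v)) / 2 - cumulant p q μ u 0
      = ∫ s, ((compensatedExp (u * p s + v * q s) + compensatedExp (u * p s - v * q s)) / 2
          - compensatedExp (u * p s)) ∂μ := by
  have hp := H.integrable_cumulant_integrand u v
  have hm := H.integrable_cumulant_integrand_neg u v
  simp only [cumulant, neg_mul, ← sub_eq_add_neg, zero_mul, add_zero]
  rw [← integral_add hp hm, ← integral_div, ← integral_sub ((hp.fun_add hm).div_const 2)
    (integrable_compensatedExp_comp (H.integrable_fst.const_mul u))]

theorem norm_cumulant_even_part_add_le (H : BoundedOrthogonalPair p q μ M m₀ m₂) {v : ℝ} (u : ℝ)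
    (hv : |v| * (2 * M) ≤ 1) :
    ‖(cumulant p q μ u v + cumulant p q μ u (-v)) / 2 - cumulant p q μ u 0
      + (m₂ * v ^ 2 / 2 : ℝ)‖ ≤ M * m₂ * v ^ 2 * (|u| + |v|) := by
  have hsq : m₂ * v ^ 2 / 2 = ∫ s, (v * q s) ^ 2 / 2 ∂μ := by
    simp_rw [mul_pow]
    rw [integral_div, integral_const_mul, H.integral_sq_snd]
    ring
  have hint : Integrable (fun s => (((v * q s) ^ 2 / 2 : ℝ) : ℂ)) μ := by
    simp_rw [mul_pow]
    exact ((H.integrable_sq_snd.const_mul _).div_const 2).ofReal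
  rw [H.cumulant_even_part, hsq, ← integral_complex_ofReal,
    ← integral_add (H.integrable_cumulant_even_integrand u v) hint]
  refine (H.norm_integral_le (c₀ := 0) (c₂ := M * v ^ 2 * (|u| + |v|)) fun s => ?_).trans_eq
    (by ring)
  have hup : |u * p s| ≤ |u| * M := by rw [abs_mul]; gcongr; exact H.abs_fst_le s
  have hvq : |v * q s| ≤ 1 := by linarith [H.abs_const_mul_snd_le hv s]
  have hcube : |v| ^ 3 = v ^ 2 * |v| := by rw [← sq_abs]; ring
  calc _ ≤ |u * p s| * ((v * q s) ^ 2 / 2) + |v * q s| ^ 3 :=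
        norm_compensatedExp_even_part_add_le _ hvq
    _ ≤ |u| * M * (v * q s) ^ 2 + M * |v| ^ 3 * q s ^ 2 := by
        refine add_le_add ?_ (H.abs_const_mul_snd_pow_three_le v s)
        exact mul_le_mul hup (half_le_self (sq_nonneg _)) (by positivity)
          ((abs_nonneg _).trans hup)
    _ = _ := by rw [hcube]; ring

theorem re_cumulant_even_part_nonpos (H : BoundedOrthogonalPair p q μ M m₀ m₂) {u : ℝ} (v : ℝ)
    (hu : |u| * (2 * M) ≤ 1) :
    ((cumulant p q μ u v + cumulant p q μ u (-v)) / 2 - cumulant p q μ u 0).re ≤ 0 := by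
  rw [H.cumulant_even_part, ← RCLike.re_eq_complex_re,
    ← integral_re (H.integrable_cumulant_even_integrand u v)]
  exact integral_nonpos fun s => re_compensatedExp_even_part_nonpos
    (by linarith [H.abs_const_mul_fst_le hu s]) _

theorem cumulant_odd_part (H : BoundedOrthogonalPair p q μ M m₀ m₂) (u v : ℝ) :
    (cumulant p q μ u v - cumulant p q μ u (-v)) / 2
      = ∫ s, ((compensatedExp (u * p s + v * q s) - compensatedExp (u * p s - v * q s)) / 2
          + (u * p s * (v * q s) : ℝ)) ∂μ := by
  have hp := H.integrable_cumulant_integrand u v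
  have hm := H.integrable_cumulant_integrand_neg u v
  have hsub : Integrable (fun s =>
      (compensatedExp (u * p s + v * q s) - compensatedExp (u * p s - v * q s)) / 2) μ :=
    (hp.sub hm).div_const 2
  have hmul : Integrable (fun s => ((u * p s * (v * q s) : ℝ) : ℂ)) μ := by
    simp_rw [mul_mul_mul_comm u]
    exact (H.integrable_mul.const_mul (u * v)).ofReal
  have horth : ∫ s, u * p s * (v * q s) ∂μ = 0 := by
    simp_rw [mul_mul_mul_comm u]
    rw [integral_const_mul, H.orthogonal, mul_zero]
  rw [integral_add hsub hmul, integral_div, integral_sub hp hm, integral_complex_ofReal, horth,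
    Complex.ofReal_zero, add_zero]
  simp only [cumulant, neg_mul, ← sub_eq_add_neg]

theorem norm_cumulant_odd_part_le (H : BoundedOrthogonalPair p q μ M m₀ m₂) {u v : ℝ}
    (hu : |u| * (2 * M) ≤ 1) (hv : |v| * (2 * M) ≤ 1) :
    ‖(cumulant p q μ u v - cumulant p q μ u (-v)) / 2‖
      ≤ M * |v| * (m₀ * u ^ 2 + 2 * m₂ * v ^ 2) := by
  rw [H.cumulant_odd_part]
  refine (H.norm_integral_le (c₀ := M * |v| * u ^ 2) (c₂ := 2 * (M * |v| ^ 3))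
    fun s => ?_).trans_eq (by rw [← sq_abs v]; ring)
  have hvq : |v * q s| ≤ |v| * M := by rw [abs_mul]; gcongr; exact H.abs_snd_le s
  calc _ ≤ (u * p s) ^ 2 * |v * q s| + 2 * |v * q s| ^ 3 :=
        norm_compensatedExp_odd_part_add_le (by linarith [H.abs_const_mul_fst_le hu s])
          (by linarith [H.abs_const_mul_snd_le hv s])
    _ ≤ (u * p s) ^ 2 * (|v| * M) + 2 * (M * |v| ^ 3 * q s ^ 2) := by
        gcongr
        exact H.abs_const_mul_snd_pow_three_le v s
    _ = _ := by ring

end BoundedOrthogonalPair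

end Cumulant

section SecondDifference

/-- A bound, uniform in `x`, of `m |x|³ exp (-m x² / 4)`. For `m = 0` both vanish, since
`32 / 0 = 0`. -/
noncomputable def gaussianCubeBound (m : ℝ) : ℝ := m + 32 / m

theorem gaussianCubeBound_nonneg {m : ℝ} (hm : 0 ≤ m) : 0 ≤ gaussianCubeBound m :=
  add_nonneg hm (div_nonneg (by norm_num) hm)

theorem mul_abs_pow_three_mul_exp_neg_le {m : ℝ} (hm : 0 ≤ m) (x : ℝ) :
    m * |x| ^ 3 * Real.exp (-(m * x ^ 2 / 4)) ≤ gaussianCubeBound m := by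
  rcases hm.eq_or_lt with rfl | hm
  · simp [gaussianCubeBound]
  have hcube : |x| ^ 3 ≤ 1 + |x| ^ 4 := by
    rcases le_total |x| 1 with hx | hx
    · exact (pow_le_one₀ (abs_nonneg x) hx).trans (le_add_of_nonneg_right (by positivity))
    · exact (pow_le_pow_right₀ hx (by norm_num)).trans (le_add_of_nonneg_left zero_le_one)
  have hquartic : m * |x| ^ 4 ≤ 32 / m * Real.exp (m * x ^ 2 / 4) := by
    have h := Real.pow_div_factorial_le_exp (m * x ^ 2 / 4) (by positivity) 2
    calc m * |x| ^ 4 = 32 / m * ((m * x ^ 2 / 4) ^ 2 / (Nat.factorial 2 : ℕ)) := by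
          rw [Even.pow_abs (by decide)]
          field_simp
          norm_num [Nat.factorial]
          ring
      _ ≤ 32 / m * Real.exp (m * x ^ 2 / 4) := by gcongr
  have hone : 1 ≤ Real.exp (m * x ^ 2 / 4) := Real.one_le_exp (by positivity)
  rw [Real.exp_neg, ← div_eq_mul_inv, div_le_iff₀ (Real.exp_pos _), gaussianCubeBound]
  linarith [mul_le_mul_of_nonneg_left hcube hm.le, mul_le_mul_of_nonneg_left hone hm.le]

theorem cexp_sub_half_cexp_add_cexp (a b c : ℂ) :
    cexp c - (cexp a + cexp b) / 2
      = cexp c * (1 - cexp ((a + b) / 2 - c)) - (cexp (a / 2) - cexp (b / 2)) ^ 2 / 2 := by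
  have hsq (z : ℂ) : cexp (z / 2) ^ 2 = cexp z := by
    rw [← Complex.exp_nat_mul]
    congr 1
    push_cast
    ring
  have hmul : cexp c * cexp ((a + b) / 2 - c) = cexp (a / 2) * cexp (b / 2) := by
    rw [← Complex.exp_add, ← Complex.exp_add]
    congr 1
    ring
  linear_combination hmul + (hsq a + hsq b) / 2

variable {α : Type*} [MeasurableSpace α] {μ : Measure α} {p q : α → ℝ} {M m₀ m₂ : ℝ}

/-- The constant, for variances `m₀` and `m₂`, in the comparison of second differences with those
of a Gaussian characteristic function. -/
noncomputable def secondDifferenceConst (m₀ m₂ : ℝ) : ℝ :=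
  2 * (gaussianCubeBound m₀ + gaussianCubeBound m₂) * (m₂ + 4) + m₂
    + (m₀ * gaussianCubeBound m₀ / 2 + 2 * m₂ ^ 2)

theorem secondDifferenceConst_nonneg {m₀ m₂ : ℝ} (hm₀ : 0 ≤ m₀) (hm₂ : 0 ≤ m₂) :
    0 ≤ secondDifferenceConst m₀ m₂ := by
  have hK₀ := gaussianCubeBound_nonneg hm₀
  have hK₂ := gaussianCubeBound_nonneg hm₂
  rw [secondDifferenceConst]
  positivity

/-- Minus half the second difference at `(u, 0)`, in the second variable, of the characteristic
function `exp ∘ cumulant` of a pair `(Y, W)`; it is `E e^{iuY} (1 - cos (v W))`. -/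
noncomputable def secondDifference (p q : α → ℝ) (μ : Measure α) (u v : ℝ) : ℂ :=
  cexp (cumulant p q μ u 0) - (cexp (cumulant p q μ u v) + cexp (cumulant p q μ u (-v))) / 2

/-- The value `e^{-m₀u²/2} (1 - e^{-m₂v²/2})` of `E e^{iuY} (1 - cos (v W))` for independent centred
Gaussian variables `Y` and `W` with variances `m₀` and `m₂`. -/
noncomputable def gaussianSecondDifference (m₀ m₂ u v : ℝ) : ℝ :=
  Real.exp (-(m₀ * u ^ 2 / 2)) * (1 - Real.exp (-(m₂ * v ^ 2 / 2)))

theorem abs_gaussianSecondDifference_le_one (hm₀ : 0 ≤ m₀) (hm₂ : 0 ≤ m₂) (u v : ℝ) :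
    |gaussianSecondDifference m₀ m₂ u v| ≤ 1 := by
  have hu : Real.exp (-(m₀ * u ^ 2 / 2)) ≤ 1 := Real.exp_le_one_iff.2 (neg_nonpos.2 (by positivity))
  have hv : Real.exp (-(m₂ * v ^ 2 / 2)) ≤ 1 := Real.exp_le_one_iff.2 (neg_nonpos.2 (by positivity))
  have hv' : 0 ≤ 1 - Real.exp (-(m₂ * v ^ 2 / 2)) := sub_nonneg.2 hv
  rw [gaussianSecondDifference, abs_of_nonneg (by positivity)]
  exact mul_le_one₀ hu hv' (sub_le_self _ (Real.exp_pos _).le)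

namespace BoundedOrthogonalPair

theorem norm_secondDifference_sub_le_three (H : BoundedOrthogonalPair p q μ M m₀ m₂) (u v : ℝ) :
    ‖secondDifference p q μ u v - gaussianSecondDifference m₀ m₂ u v‖ ≤ 3 := by
  have hhalf : ‖(cexp (cumulant p q μ u v) + cexp (cumulant p q μ u (-v))) / 2‖ ≤ 1 := by
    rw [norm_div, RCLike.norm_ofNat, div_le_one zero_lt_two]
    linarith [norm_add_le (cexp (cumulant p q μ u v)) (cexp (cumulant p q μ u (-v))),
      H.norm_cexp_cumulant_le_one u v, H.norm_cexp_cumulant_le_one u (-v)]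
  refine (norm_sub_le _ _).trans ?_
  rw [Complex.norm_real, Real.norm_eq_abs, secondDifference]
  linarith [abs_gaussianSecondDifference_le_one H.nonneg_fst H.nonneg_snd u v,
    norm_sub_le (cexp (cumulant p q μ u 0))
      ((cexp (cumulant p q μ u v) + cexp (cumulant p q μ u (-v))) / 2),
    H.norm_cexp_cumulant_le_one u 0]

theorem norm_cexp_cumulant_sub_exp_le (H : BoundedOrthogonalPair p q μ M m₀ m₂) {u v : ℝ}
    (hu : |u| * (2 * M) ≤ 1) (hv : |v| * (2 * M) ≤ 1) :
    ‖cexp (cumulant p q μ u v) - (Real.exp (-((m₀ * u ^ 2 + m₂ * v ^ 2) / 2)) : ℝ)‖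
      ≤ 4 * M * (gaussianCubeBound m₀ + gaussianCubeBound m₂) := by
  have hM := H.pos
  have h₀ : 0 ≤ m₀ * u ^ 2 := mul_nonneg H.nonneg_fst (sq_nonneg u)
  have h₂ : 0 ≤ m₂ * v ^ 2 := mul_nonneg H.nonneg_snd (sq_nonneg v)
  have hu3 : 0 ≤ m₀ * |u| ^ 3 := mul_nonneg H.nonneg_fst (by positivity)
  have hv3 : 0 ≤ m₂ * |v| ^ 3 := mul_nonneg H.nonneg_snd (by positivity)
  have hexp := norm_cexp_sub_cexp_le_of_re_le (H.re_cumulant_le hu hv)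
    (b := (-((m₀ * u ^ 2 + m₂ * v ^ 2) / 2) : ℝ)) (by rw [Complex.ofReal_re]; linarith)
  rw [Complex.ofReal_neg, sub_neg_eq_add, ← Complex.ofReal_neg, ← Complex.ofReal_exp] at hexp
  calc _ ≤ Real.exp (-((m₀ * u ^ 2 + m₂ * v ^ 2) / 4))
        * (4 * M * (m₀ * |u| ^ 3 + m₂ * |v| ^ 3)) :=
        hexp.trans (by gcongr; exact H.norm_cumulant_add_le hu hv)
    _ = 4 * M * (m₀ * |u| ^ 3 * Real.exp (-((m₀ * u ^ 2 + m₂ * v ^ 2) / 4))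
        + m₂ * |v| ^ 3 * Real.exp (-((m₀ * u ^ 2 + m₂ * v ^ 2) / 4))) := by ring
    _ ≤ 4 * M * (m₀ * |u| ^ 3 * Real.exp (-(m₀ * u ^ 2 / 4))
        + m₂ * |v| ^ 3 * Real.exp (-(m₂ * v ^ 2 / 4))) := by
        gcongr <;> linarith
    _ ≤ 4 * M * (gaussianCubeBound m₀ + gaussianCubeBound m₂) := by
        gcongr
        · exact mul_abs_pow_three_mul_exp_neg_le H.nonneg_fst u
        · exact mul_abs_pow_three_mul_exp_neg_le H.nonneg_snd v

theorem norm_cexp_cumulant_zero_sub_exp_le (H : BoundedOrthogonalPair p q μ M m₀ m₂) {u : ℝ}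
    (hu : |u| * (2 * M) ≤ 1) :
    ‖cexp (cumulant p q μ u 0) - (Real.exp (-(m₀ * u ^ 2 / 2)) : ℝ)‖
      ≤ 4 * M * (gaussianCubeBound m₀ + gaussianCubeBound m₂) := by
  simpa using H.norm_cexp_cumulant_sub_exp_le hu (v := 0) (by simp)

theorem norm_secondDifference_sub_le (H : BoundedOrthogonalPair p q μ M m₀ m₂) {u v : ℝ}
    (hu : |u| * (2 * M) ≤ 1) (hv : |v| * (2 * M) ≤ 1) :
    ‖secondDifference p q μ u v - gaussianSecondDifference m₀ m₂ u v‖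
      ≤ 8 * M * (gaussianCubeBound m₀ + gaussianCubeBound m₂) := by
  have h₀ := H.norm_cexp_cumulant_zero_sub_exp_le hu
  have hpos := H.norm_cexp_cumulant_sub_exp_le hu hv
  have hneg := H.norm_cexp_cumulant_sub_exp_le hu (v := -v) (by rwa [abs_neg])
  rw [neg_sq] at hneg
  set G := Real.exp (-((m₀ * u ^ 2 + m₂ * v ^ 2) / 2)) with hG
  have hsplit : secondDifference p q μ u v - gaussianSecondDifference m₀ m₂ u v
      = (cexp (cumulant p q μ u 0) - (Real.exp (-(m₀ * u ^ 2 / 2)) : ℝ))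
        - ((cexp (cumulant p q μ u v) - G) + (cexp (cumulant p q μ u (-v)) - G)) / 2 := by
    rw [hG, show -((m₀ * u ^ 2 + m₂ * v ^ 2) / 2) = -(m₀ * u ^ 2 / 2) + -(m₂ * v ^ 2 / 2) by ring,
      Real.exp_add, secondDifference, gaussianSecondDifference]
    push_cast
    ring
  rw [hsplit]
  refine (norm_sub_le _ _).trans ?_
  rw [norm_div, RCLike.norm_ofNat]
  linarith [norm_add_le (cexp (cumulant p q μ u v) - G) (cexp (cumulant p q μ u (-v)) - G)]

theorem norm_cexp_cumulant_zero_sub_mul_le (H : BoundedOrthogonalPair p q μ M m₀ m₂) {u : ℝ}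
    (hu : |u| * (2 * M) ≤ 1) (v : ℝ) :
    ‖(cexp (cumulant p q μ u 0) - (Real.exp (-(m₀ * u ^ 2 / 2)) : ℝ))
        * (1 - Real.exp (-(m₂ * v ^ 2 / 2)) : ℝ)‖
      ≤ v ^ 2 * (M * (2 * (gaussianCubeBound m₀ + gaussianCubeBound m₂) * m₂)) := by
  have h₂ : 0 ≤ m₂ * v ^ 2 := mul_nonneg H.nonneg_snd (sq_nonneg v)
  have hexp : |1 - Real.exp (-(m₂ * v ^ 2 / 2))| ≤ m₂ * v ^ 2 / 2 := by
    rw [abs_of_nonneg (sub_nonneg.2 (Real.exp_le_one_iff.2 (by linarith)))]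
    linarith [Real.one_sub_le_exp_neg (m₂ * v ^ 2 / 2)]
  rw [norm_mul, Complex.norm_real, Real.norm_eq_abs]
  refine (mul_le_mul (H.norm_cexp_cumulant_zero_sub_exp_le hu) hexp (abs_nonneg _)
    ((norm_nonneg _).trans (H.norm_cexp_cumulant_zero_sub_exp_le hu))).trans_eq ?_
  ring

theorem norm_cexp_cumulant_zero_mul_sub_le (H : BoundedOrthogonalPair p q μ M m₀ m₂) {u v : ℝ}
    (hu : |u| * (2 * M) ≤ 1) (hv : |v| * (2 * M) ≤ 1) :
    ‖cexp (cumulant p q μ u 0) * ((Real.exp (-(m₂ * v ^ 2 / 2)) : ℝ)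
        - cexp ((cumulant p q μ u v + cumulant p q μ u (-v)) / 2 - cumulant p q μ u 0))‖
      ≤ M * m₂ * v ^ 2 * (|u| + |v|) := by
  have h₂ : 0 ≤ m₂ * v ^ 2 := mul_nonneg H.nonneg_snd (sq_nonneg v)
  have hexp := norm_cexp_sub_cexp_le_of_re_le (r := 0) (H.re_cumulant_even_part_nonpos v hu)
    (b := (-(m₂ * v ^ 2 / 2) : ℝ)) (by rw [Complex.ofReal_re]; linarith)
  rw [Real.exp_zero, one_mul, Complex.ofReal_neg, sub_neg_eq_add, ← Complex.ofReal_neg,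
    ← Complex.ofReal_exp, norm_sub_rev] at hexp
  rw [norm_mul]
  exact (mul_le_of_le_one_left (norm_nonneg _) (H.norm_cexp_cumulant_le_one u 0)).trans
    (hexp.trans (H.norm_cumulant_even_part_add_le u hv))

theorem norm_cexp_half_cumulant_sub_le (H : BoundedOrthogonalPair p q μ M m₀ m₂) {u v : ℝ}
    (hu : |u| * (2 * M) ≤ 1) (hv : |v| * (2 * M) ≤ 1) :
    ‖cexp (cumulant p q μ u v / 2) - cexp (cumulant p q μ u (-v) / 2)‖
      ≤ Real.exp (-(m₀ * u ^ 2 / 8)) * (M * |v| * (m₀ * u ^ 2 + 2 * m₂ * v ^ 2)) := by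
  have h₂ : 0 ≤ m₂ * v ^ 2 := mul_nonneg H.nonneg_snd (sq_nonneg v)
  have hre (w : ℝ) (hw : |w| * (2 * M) ≤ 1) (hwv : w ^ 2 = v ^ 2) :
      (cumulant p q μ u w / 2).re ≤ -(m₀ * u ^ 2 / 8) := by
    have h := H.re_cumulant_le hu hw
    rw [hwv] at h
    rw [Complex.div_ofNat_re]
    linarith
  refine (norm_cexp_sub_cexp_le_of_re_le (hre v hv rfl)
    (hre (-v) (by rwa [abs_neg]) (neg_sq v))).trans ?_
  rw [← sub_div]
  gcongr
  exact H.norm_cumulant_odd_part_le hu hv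

theorem norm_cexp_half_cumulant_sub_sq_le (H : BoundedOrthogonalPair p q μ M m₀ m₂) {u v : ℝ}
    (hu : |u| * (2 * M) ≤ 1) (hv : |v| * (2 * M) ≤ 1) (hv1 : |v| ≤ 1) :
    ‖(cexp (cumulant p q μ u v / 2) - cexp (cumulant p q μ u (-v) / 2)) ^ 2 / 2‖
      ≤ v ^ 2 * (M * (m₀ * gaussianCubeBound m₀ / 2 + 2 * m₂ ^ 2)) := by
  have hM := H.pos
  have hm₀ := H.nonneg_fst
  set E := Real.exp (-(m₀ * u ^ 2 / 4)) with hE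
  have hE1 : E ≤ 1 := Real.exp_le_one_iff.2 (neg_nonpos.2 (by positivity))
  have hEsq : Real.exp (-(m₀ * u ^ 2 / 8)) ^ 2 = E := by
    rw [← Real.exp_nat_mul, hE]
    congr 1
    push_cast
    ring
  have hfst : M * (m₀ ^ 2 * |u| ^ 4 * E) ≤ m₀ * gaussianCubeBound m₀ / 2 := by
    calc M * (m₀ ^ 2 * |u| ^ 4 * E) = m₀ * (|u| * (2 * M) * (m₀ * |u| ^ 3 * E)) / 2 := by ring
      _ ≤ m₀ * (1 * gaussianCubeBound m₀) / 2 := by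
          gcongr
          exact mul_abs_pow_three_mul_exp_neg_le hm₀ u
      _ = m₀ * gaussianCubeBound m₀ / 2 := by rw [one_mul]
  have hsnd : M * (4 * m₂ ^ 2 * |v| ^ 4 * E) ≤ 2 * m₂ ^ 2 := by
    calc M * (4 * m₂ ^ 2 * |v| ^ 4 * E) = 2 * m₂ ^ 2 * (|v| * (2 * M) * |v| ^ 3 * E) := by ring
      _ ≤ 2 * m₂ ^ 2 * (1 * 1 ^ 3 * 1) := by gcongr
      _ = 2 * m₂ ^ 2 := by ring
  rw [norm_div, norm_pow, RCLike.norm_ofNat]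
  calc _ ≤ (Real.exp (-(m₀ * u ^ 2 / 8)) * (M * |v| * (m₀ * u ^ 2 + 2 * m₂ * v ^ 2))) ^ 2 / 2 := by
        gcongr
        exact H.norm_cexp_half_cumulant_sub_le hu hv
    _ = E * M ^ 2 * |v| ^ 2 * ((m₀ * |u| ^ 2 + 2 * m₂ * |v| ^ 2) ^ 2 / 2) := by
        rw [← hEsq, ← sq_abs u, ← sq_abs v]
        ring
    _ ≤ E * M ^ 2 * |v| ^ 2 * ((m₀ * |u| ^ 2) ^ 2 + (2 * m₂ * |v| ^ 2) ^ 2) := by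
        gcongr
        linarith [add_sq_le (a := m₀ * |u| ^ 2) (b := 2 * m₂ * |v| ^ 2)]
    _ = v ^ 2 * (M * (M * (m₀ ^ 2 * |u| ^ 4 * E) + M * (4 * m₂ ^ 2 * |v| ^ 4 * E))) := by
        rw [← sq_abs v]
        ring
    _ ≤ _ := by gcongr

theorem norm_secondDifference_sub_le_sq_mul (H : BoundedOrthogonalPair p q μ M m₀ m₂) {u v : ℝ}
    (hu : |u| * (2 * M) ≤ 1) (hv : |v| * (2 * M) ≤ 1) (hv1 : |v| ≤ 1) :
    ‖secondDifference p q μ u v - gaussianSecondDifference m₀ m₂ u v‖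
      ≤ v ^ 2 * (M * secondDifferenceConst m₀ m₂ * (1 + |u|)) := by
  have hM := H.pos
  have hm₀ := H.nonneg_fst
  have hm₂ := H.nonneg_snd
  have hK₀ := gaussianCubeBound_nonneg hm₀
  have hK₂ := gaussianCubeBound_nonneg hm₂
  have hsplit : secondDifference p q μ u v - gaussianSecondDifference m₀ m₂ u v
      = (cexp (cumulant p q μ u 0) - (Real.exp (-(m₀ * u ^ 2 / 2)) : ℝ))
          * (1 - Real.exp (-(m₂ * v ^ 2 / 2)) : ℝ)
        + cexp (cumulant p q μ u 0) * ((Real.exp (-(m₂ * v ^ 2 / 2)) : ℝ)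
          - cexp ((cumulant p q μ u v + cumulant p q μ u (-v)) / 2 - cumulant p q μ u 0))
        - (cexp (cumulant p q μ u v / 2) - cexp (cumulant p q μ u (-v) / 2)) ^ 2 / 2 := by
    rw [secondDifference, cexp_sub_half_cexp_add_cexp, gaussianSecondDifference]
    push_cast
    ring
  rw [hsplit]
  calc _ ≤ v ^ 2 * (M * (2 * (gaussianCubeBound m₀ + gaussianCubeBound m₂) * m₂))
        + M * m₂ * v ^ 2 * (|u| + |v|)
        + v ^ 2 * (M * (m₀ * gaussianCubeBound m₀ / 2 + 2 * m₂ ^ 2)) :=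
        (norm_sub_le _ _).trans (add_le_add ((norm_add_le _ _).trans (add_le_add
          (H.norm_cexp_cumulant_zero_sub_mul_le hu v)
          (H.norm_cexp_cumulant_zero_mul_sub_le hu hv)))
          (H.norm_cexp_half_cumulant_sub_sq_le hu hv hv1))
    _ ≤ v ^ 2 * (M * (2 * (gaussianCubeBound m₀ + gaussianCubeBound m₂) * m₂))
          * (1 + |u|)
        + M * m₂ * v ^ 2 * (1 + |u|)
        + v ^ 2 * (M * (m₀ * gaussianCubeBound m₀ / 2 + 2 * m₂ ^ 2)) * (1 + |u|) := by
        have hone : 1 ≤ 1 + |u| := le_add_of_nonneg_right (abs_nonneg u)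
        gcongr ?_ + M * m₂ * v ^ 2 * ?_ + ?_
        · exact le_mul_of_one_le_right (by positivity) hone
        · linarith
        · exact le_mul_of_one_le_right (by positivity) hone
    _ ≤ v ^ 2 * (M * secondDifferenceConst m₀ m₂ * (1 + |u|)) := by
        have : 0 ≤ v ^ 2 * (M * (gaussianCubeBound m₀ + gaussianCubeBound m₂) * (1 + |u|)) := by
          positivity
        rw [secondDifferenceConst]
        linarith

theorem norm_secondDifference_sub_div_sq_le_of_le_one (H : BoundedOrthogonalPair p q μ M m₀ m₂)
    {u v : ℝ} (hu : |u| * (2 * M) ≤ 1) (hv : |v| * (2 * M) ≤ 1) :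
    ‖secondDifference p q μ u v - gaussianSecondDifference m₀ m₂ u v‖ / v ^ 2
      ≤ 2 * (M * secondDifferenceConst m₀ m₂ * (1 + |u|)) * (1 + v ^ 2)⁻¹ := by
  have hM := H.pos
  have hA := secondDifferenceConst_nonneg H.nonneg_fst H.nonneg_snd
  set B := M * secondDifferenceConst m₀ m₂ * (1 + |u|)
  have : 0 ≤ B := by positivity
  refine div_le_of_le_mul₀ (sq_nonneg v) (by positivity) ?_
  rw [← div_eq_mul_inv, div_mul_eq_mul_div, le_div_iff₀ (by positivity)]
  rcases le_or_gt |v| 1 with hv1 | hv1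
  · have hsq : 1 + v ^ 2 ≤ 2 := by linarith [(sq_le_one_iff_abs_le_one v).2 hv1]
    calc _ ≤ v ^ 2 * B * 2 := by
          gcongr
          exact H.norm_secondDifference_sub_le_sq_mul hu hv hv1
      _ = 2 * B * v ^ 2 := by ring
  · have hsq : 1 ≤ v ^ 2 := ((one_lt_sq_iff_one_lt_abs v).2 hv1).le
    have hlarge : 8 * M * (gaussianCubeBound m₀ + gaussianCubeBound m₂) ≤ B := by
      have hm₀ := H.nonneg_fst
      have hm₂ := H.nonneg_snd
      have hK₀ := gaussianCubeBound_nonneg hm₀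
      have hK₂ := gaussianCubeBound_nonneg hm₂
      refine le_trans ?_ (le_mul_of_one_le_right (by positivity)
        (le_add_of_nonneg_right (abs_nonneg u)))
      rw [secondDifferenceConst, mul_comm 8 M, mul_assoc]
      gcongr
      have : 0 ≤ 2 * (gaussianCubeBound m₀ + gaussianCubeBound m₂) * m₂ + m₂
          + (m₀ * gaussianCubeBound m₀ / 2 + 2 * m₂ ^ 2) := by positivity
      linarith
    calc _ ≤ B * (2 * v ^ 2) := by
          gcongr
          · exact (H.norm_secondDifference_sub_le hu hv).trans hlarge
          · linarith
      _ = 2 * B * v ^ 2 := by ring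

theorem norm_secondDifference_sub_div_sq_le_of_one_lt (H : BoundedOrthogonalPair p q μ M m₀ m₂)
    (u : ℝ) {v : ℝ} (hv : 1 < |v| * (2 * M)) :
    ‖secondDifference p q μ u v - gaussianSecondDifference m₀ m₂ u v‖ / v ^ 2
      ≤ 24 * M ^ 2 * (1 + (2 * M * v) ^ 2)⁻¹ := by
  have hM := H.pos
  have hMv : 1 < (2 * M * v) ^ 2 := by
    rw [one_lt_sq_iff_one_lt_abs, abs_mul, abs_of_pos (by positivity : 0 < 2 * M), mul_comm]
    exact hv
  refine div_le_of_le_mul₀ (sq_nonneg v) (by positivity) ?_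
  rw [← div_eq_mul_inv, div_mul_eq_mul_div, le_div_iff₀ (by positivity)]
  calc _ ≤ 3 * (1 + (2 * M * v) ^ 2) := by
        gcongr
        exact H.norm_secondDifference_sub_le_three u v
    _ ≤ 24 * M ^ 2 * v ^ 2 := by linarith

theorem norm_secondDifference_sub_div_sq_le (H : BoundedOrthogonalPair p q μ M m₀ m₂) {u : ℝ}
    (hu : |u| * (2 * M) ≤ 1) (v : ℝ) :
    ‖secondDifference p q μ u v - gaussianSecondDifference m₀ m₂ u v‖ / v ^ 2
      ≤ 2 * (M * secondDifferenceConst m₀ m₂ * (1 + |u|)) * (1 + v ^ 2)⁻¹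
        + 24 * M ^ 2 * (1 + (2 * M * v) ^ 2)⁻¹ := by
  have hM := H.pos
  have hA := secondDifferenceConst_nonneg H.nonneg_fst H.nonneg_snd
  rcases le_or_gt (|v| * (2 * M)) 1 with hv | hv
  · exact le_add_of_le_of_nonneg (H.norm_secondDifference_sub_div_sq_le_of_le_one hu hv)
      (by positivity)
  · exact le_add_of_nonneg_of_le (by positivity)
      (H.norm_secondDifference_sub_div_sq_le_of_one_lt u hv)

theorem norm_integral_secondDifference_sub_div_sq_le (H : BoundedOrthogonalPair p q μ M m₀ m₂)
    {u : ℝ} (hu : |u| * (2 * M) ≤ 1) :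
    ‖∫ v : ℝ, (secondDifference p q μ u v - gaussianSecondDifference m₀ m₂ u v) / (v ^ 2 : ℝ)‖
      ≤ Real.pi * M * (2 * secondDifferenceConst m₀ m₂ + 12) * (1 + |u|) := by
  have hM := H.pos
  have hi₁ := integrable_inv_one_add_sq.const_mul
    (2 * (M * secondDifferenceConst m₀ m₂ * (1 + |u|)))
  have hi₂ := (integrable_inv_one_add_sq.comp_mul_left' (by positivity : 2 * M ≠ 0)).const_mul
    (24 * M ^ 2)
  have hscale : ∫ v : ℝ, (1 + (2 * M * v) ^ 2)⁻¹ = (2 * M)⁻¹ * Real.pi := by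
    rw [Measure.integral_comp_mul_left (fun v : ℝ => (1 + v ^ 2)⁻¹) (2 * M),
      integral_univ_inv_one_add_sq, smul_eq_mul, abs_of_pos (by positivity)]
  refine (norm_integral_le_of_norm_le (hi₁.add hi₂) (ae_of_all _ fun v => ?_)).trans ?_
  · rw [norm_div, Complex.norm_real, Real.norm_eq_abs, abs_sq]
    exact H.norm_secondDifference_sub_div_sq_le hu v
  · simp only [Pi.add_apply]
    rw [integral_add hi₁ hi₂, integral_const_mul, integral_const_mul, integral_univ_inv_one_add_sq,
      hscale]
    have hsnd : 24 * M ^ 2 * ((2 * M)⁻¹ * Real.pi) = Real.pi * M * 12 := by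
      field_simp
      ring
    have hu0 : 0 ≤ Real.pi * M * 12 * |u| := by positivity
    linarith

end BoundedOrthogonalPair

end SecondDifference

section CompensatedIntegral

variable {Ω : Type*} [MeasurableSpace Ω] {P : Measure Ω} {τ : ℕ → Ω → ℝ} {ν : Measure ℝ}
  {f p q : ℝ → ℝ} {M m₀ m₂ : ℝ}

/-- The compensated integral of `f` with respect to the points `τ 0, τ 1, …` of a Poisson process
with intensity `ν`. Normalized shot noise and its derivative are of this form. -/
noncomputable def compensatedIntegral (τ : ℕ → Ω → ℝ) (ν : Measure ℝ) (f : ℝ → ℝ) (ω : Ω) : ℝ :=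
  ∑' i, f (τ i ω) - ∫ s, f s ∂ν

/-- The constant in the comparison of `E e^{iuY} |W|` with its Gaussian value, for variances `m₀`
of `Y` and `m₂` of `W`. -/
noncomputable def gaussianErrorConst (m₀ m₂ : ℝ) : ℝ :=
  (∫ v, fejerKernel v)⁻¹ * (Real.pi * (2 * secondDifferenceConst m₀ m₂ + 12))

theorem gaussianErrorConst_pos (hm₀ : 0 ≤ m₀) (hm₂ : 0 ≤ m₂) : 0 < gaussianErrorConst m₀ m₂ := by
  have hA := secondDifferenceConst_nonneg hm₀ hm₂
  have hc := integral_fejerKernel_pos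
  rw [gaussianErrorConst]
  positivity

theorem integrable_gaussianSecondDifference_div_sq (hm₂ : 0 ≤ m₂) (u : ℝ) :
    Integrable (fun v => gaussianSecondDifference m₀ m₂ u v / v ^ 2) := by
  lift m₂ to ℝ≥0 using hm₂
  simp only [gaussianSecondDifference, mul_div_assoc (Real.exp _)]
  exact (integrable_one_sub_exp_div_sq m₂).const_mul _

theorem integral_gaussianSecondDifference_div_sq (hm₂ : 0 ≤ m₂) (u : ℝ) :
    ∫ v, gaussianSecondDifference m₀ m₂ u v / v ^ 2
      = (∫ v, fejerKernel v) * (√(2 * m₂ / Real.pi) * Real.exp (-(m₀ * u ^ 2 / 2))) := by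
  lift m₂ to ℝ≥0 using hm₂
  simp only [gaussianSecondDifference, mul_div_assoc (Real.exp _)]
  rw [integral_const_mul, ← integral_fejerKernel_mul_sqrt]
  ring

namespace IsPoissonPointProcess

variable [IsProbabilityMeasure P] [SigmaFinite ν]

theorem integrable_compensatedIntegral (h : IsPoissonPointProcess τ ν P) (hf : Integrable f ν) :
    Integrable (compensatedIntegral τ ν f) P :=
  (h.integrable_tsum_comp hf).sub (integrable_const _)

theorem integral_abs_compensatedIntegral_le (h : IsPoissonPointProcess τ ν P)
    (hf : Integrable f ν) :
    ∫ ω, |compensatedIntegral τ ν f ω| ∂P ≤ 2 * ∫ s, |f s| ∂ν := by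
  have hsum := (h.integrable_tsum_comp hf).norm
  calc ∫ ω, |compensatedIntegral τ ν f ω| ∂P
      ≤ ∫ ω, (‖∑' i, f (τ i ω)‖ + ‖∫ s, f s ∂ν‖) ∂P :=
        integral_mono (h.integrable_compensatedIntegral hf).abs (hsum.add (integrable_const _))
          fun ω => abs_sub (∑' i, f (τ i ω)) (∫ s, f s ∂ν)
    _ = ∫ ω, ‖∑' i, f (τ i ω)‖ ∂P + ‖∫ s, f s ∂ν‖ := by
        rw [integral_add hsum (integrable_const _), integral_const, probReal_univ, one_smul]
    _ ≤ ∫ s, |f s| ∂ν + ∫ s, |f s| ∂ν :=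
        add_le_add (h.integral_norm_tsum_comp_le hf) (norm_integral_le_integral_norm f)
    _ = 2 * ∫ s, |f s| ∂ν := (two_mul _).symm

theorem integral_cexp_compensatedIntegral (h : IsPoissonPointProcess τ ν P)
    (hf : Integrable f ν) :
    ∫ ω, cexp (I * compensatedIntegral τ ν f ω) ∂P = cexp (∫ s, compensatedExp (f s) ∂ν) := by
  have hlin : Integrable (fun s => I * (f s : ℂ)) ν := hf.ofReal.const_mul I
  simp only [compensatedIntegral, compensatedExp, Complex.ofReal_sub, mul_sub, Complex.exp_sub]
  rw [integral_div, h.integral_cexp_tsum_comp hf,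
    integral_sub (integrable_cexp_I_mul_sub_one hf) hlin, Complex.exp_sub,
    integral_const_mul, integral_complex_ofReal]

theorem ae_compensatedIntegral_add (h : IsPoissonPointProcess τ ν P) (hp : Integrable p ν)
    (hq : Integrable q ν) (u v : ℝ) :
    ∀ᵐ ω ∂P, u * compensatedIntegral τ ν p ω + v * compensatedIntegral τ ν q ω
      = compensatedIntegral τ ν (fun s => u * p s + v * q s) ω := by
  filter_upwards [h.ae_summable_norm_comp hp, h.ae_summable_norm_comp hq] with ω hpω hqω
  simp only [compensatedIntegral]
  rw [integral_add (hp.const_mul u) (hq.const_mul v), integral_const_mul, integral_const_mul,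
    (hpω.of_norm.mul_left u).tsum_add (hqω.of_norm.mul_left v), tsum_mul_left, tsum_mul_left]
  ring

theorem integral_cexp_compensatedIntegral_pair (h : IsPoissonPointProcess τ ν P)
    (hp : Integrable p ν) (hq : Integrable q ν) (u v : ℝ) :
    ∫ ω, cexp (I * (u * compensatedIntegral τ ν p ω + v * compensatedIntegral τ ν q ω : ℝ)) ∂P
      = cexp (cumulant p q ν u v) := by
  have hpq : Integrable (fun s => u * p s + v * q s) ν := (hp.const_mul u).add (hq.const_mul v)
  rw [cumulant, ← h.integral_cexp_compensatedIntegral hpq]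
  refine integral_congr_ae ?_
  filter_upwards [h.ae_compensatedIntegral_add hp hq u v] with ω hω
  rw [hω]

theorem integral_cexp_mul_one_sub_cos (h : IsPoissonPointProcess τ ν P)
    (hp : Integrable p ν) (hq : Integrable q ν) (u v : ℝ) :
    ∫ ω, cexp (I * u * compensatedIntegral τ ν p ω)
        * (1 - Real.cos (v * compensatedIntegral τ ν q ω) : ℝ) ∂P
      = secondDifference p q ν u v := by
  set Y := compensatedIntegral τ ν p with hY
  set W := compensatedIntegral τ ν q with hW
  have hYm : AEMeasurable Y P := (h.integrable_compensatedIntegral hp).1.aemeasurable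
  have hWm : AEMeasurable W P := (h.integrable_compensatedIntegral hq).1.aemeasurable
  have hint (w : ℝ) : Integrable (fun ω => cexp (I * (u * Y ω + w * W ω : ℝ))) P :=
    .of_bound (C := 1) (AEMeasurable.aestronglyMeasurable (by fun_prop))
      (ae_of_all _ fun ω => (Complex.norm_exp_I_mul_ofReal _).le)
  have hsplit (ω : Ω) : cexp (I * u * Y ω) * (1 - Real.cos (v * W ω) : ℝ)
      = cexp (I * (u * Y ω + 0 * W ω : ℝ))
        - (cexp (I * (u * Y ω + v * W ω : ℝ)) + cexp (I * (u * Y ω + -v * W ω : ℝ))) / 2 := by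
    rw [mul_assoc I, ← Complex.ofReal_mul]
    simp only [neg_mul, cexp_I_mul_ofReal_add, zero_mul, Real.cos_zero, Real.sin_zero,
      Real.cos_neg, Real.sin_neg]
    push_cast
    ring
  have hmean : Integrable (fun ω => (cexp (I * (u * Y ω + v * W ω : ℝ))
      + cexp (I * (u * Y ω + -v * W ω : ℝ))) / 2) P :=
    ((hint v).add (hint (-v))).div_const 2
  simp_rw [hsplit]
  rw [integral_sub (hint 0) hmean, integral_div,
    integral_add (hint v) (hint (-v))]
  simp only [hY, hW, h.integral_cexp_compensatedIntegral_pair hp hq, secondDifference]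

theorem aestronglyMeasurable_cexp_compensatedIntegral (h : IsPoissonPointProcess τ ν P)
    (hp : Integrable p ν) (u : ℝ) :
    AEStronglyMeasurable (fun ω => cexp (I * u * compensatedIntegral τ ν p ω)) P :=
  have hYm := (h.integrable_compensatedIntegral hp).1.aemeasurable
  AEMeasurable.aestronglyMeasurable (by fun_prop)

theorem integral_cexp_mul_one_sub_cos_div_sq (h : IsPoissonPointProcess τ ν P)
    (hp : Integrable p ν) (hq : Integrable q ν) (u v : ℝ) :
    ∫ ω, cexp (I * u * compensatedIntegral τ ν p ω)
        * ((1 - Real.cos (v * compensatedIntegral τ ν q ω)) / v ^ 2 : ℝ) ∂P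
      = secondDifference p q ν u v / (v ^ 2 : ℝ) := by
  simp_rw [Complex.ofReal_div, ← mul_div_assoc]
  rw [integral_div, h.integral_cexp_mul_one_sub_cos hp hq]

theorem integrable_secondDifference_div_sq (h : IsPoissonPointProcess τ ν P)
    (hp : Integrable p ν) (hq : Integrable q ν) (u : ℝ) :
    Integrable fun v : ℝ => secondDifference p q ν u v / (v ^ 2 : ℝ) := by
  simp_rw [← h.integral_cexp_mul_one_sub_cos_div_sq hp hq]
  exact (integrable_prod_mul_one_sub_cos_mul_div_sq
    (h.aestronglyMeasurable_cexp_compensatedIntegral hp u)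
    (fun _ => (norm_cexp_I_mul_ofReal_mul_ofReal _ _).le)
    (h.integrable_compensatedIntegral hq)).integral_prod_right

theorem integral_fejerKernel_mul_integral_cexp_mul_abs (h : IsPoissonPointProcess τ ν P)
    (hp : Integrable p ν) (hq : Integrable q ν) (u : ℝ) :
    ((∫ v, fejerKernel v : ℝ) : ℂ) * ∫ ω, cexp (I * u * compensatedIntegral τ ν p ω)
        * (|compensatedIntegral τ ν q ω| : ℝ) ∂P
      = ∫ v : ℝ, secondDifference p q ν u v / (v ^ 2 : ℝ) := by
  simp_rw [← h.integral_cexp_mul_one_sub_cos_div_sq hp hq]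
  exact integral_fejerKernel_mul_integral_mul_abs
    (h.aestronglyMeasurable_cexp_compensatedIntegral hp u)
    (fun _ => (norm_cexp_I_mul_ofReal_mul_ofReal _ _).le) (h.integrable_compensatedIntegral hq)

theorem norm_integral_cexp_mul_abs_sub_le (h : IsPoissonPointProcess τ ν P)
    (H : BoundedOrthogonalPair p q ν M m₀ m₂) {u : ℝ} (hu : |u| * (2 * M) ≤ 1) :
    ‖∫ ω, cexp (I * u * compensatedIntegral τ ν p ω)
          * (|compensatedIntegral τ ν q ω| : ℝ) ∂P
        - (√(2 * m₂ / Real.pi) * Real.exp (-(m₀ * u ^ 2 / 2)) : ℝ)‖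
      ≤ M * gaussianErrorConst m₀ m₂ * (1 + |u|) := by
  have hpoisson := h.integrable_secondDifference_div_sq H.integrable_fst H.integrable_snd u
  have hgauss : Integrable fun v => ((gaussianSecondDifference m₀ m₂ u v / v ^ 2 : ℝ) : ℂ) :=
    (integrable_gaussianSecondDifference_div_sq H.nonneg_snd u).ofReal
  have hc := integral_fejerKernel_pos
  set c := ∫ v, fejerKernel v with hc_def
  have hdiff : (c : ℂ) * (∫ ω, cexp (I * u * compensatedIntegral τ ν p ω)
          * (|compensatedIntegral τ ν q ω| : ℝ) ∂P
        - (√(2 * m₂ / Real.pi) * Real.exp (-(m₀ * u ^ 2 / 2)) : ℝ))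
      = ∫ v : ℝ, (secondDifference p q ν u v - gaussianSecondDifference m₀ m₂ u v)
          / (v ^ 2 : ℝ) := by
    simp_rw [sub_div, ← Complex.ofReal_div]
    rw [integral_sub hpoisson hgauss, integral_complex_ofReal,
      integral_gaussianSecondDifference_div_sq H.nonneg_snd, mul_sub,
      h.integral_fejerKernel_mul_integral_cexp_mul_abs H.integrable_fst H.integrable_snd,
      ← hc_def, Complex.ofReal_mul c]
  have hbound := H.norm_integral_secondDifference_sub_div_sq_le hu
  rw [← hdiff, norm_mul, Complex.norm_real, Real.norm_of_nonneg hc.le, ← le_div_iff₀' hc] at hbound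
  refine hbound.trans_eq ?_
  rw [gaussianErrorConst, ← hc_def]
  ring

end IsPoissonPointProcess

end CompensatedIntegral

section MeanCrossings

variable {Ω : Type*} [MeasurableSpace Ω] {P : Measure Ω}

theorem meanCrossings_congr_ae {Z Y : ℝ → Ω → ℝ} (h : ∀ᵐ ω ∂P, ∀ t, Z t ω = Y t ω) (a b : ℝ) :
    meanCrossings P Z a b = meanCrossings P Y a b := by
  funext α
  refine lintegral_congr_ae (h.mono fun ω hω => ?_)
  simp only [hω]

namespace HasC1Paths

variable {Y Y' : ℝ → Ω → ℝ}

theorem sub_const_div_const (h : HasC1Paths Y Y') (c r : ℝ) :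
    HasC1Paths (fun t ω => (Y t ω - c) / r) (fun t ω => Y' t ω / r) where
  measurable t := ((h.measurable t).sub_const c).div_const r
  hasDerivAt ω t := ((h.hasDerivAt ω t).sub_const c).div_const r
  continuous_deriv ω := (h.continuous_deriv ω).div_const r

theorem integrable_prod_of_integral_abs_le [IsFiniteMeasure P] (h : HasC1Paths Y Y')
    (hi : ∀ t, Integrable (Y' t) P) {C : ℝ} (hC : ∀ t, ∫ ω, |Y' t ω| ∂P ≤ C) (a b : ℝ) :
    Integrable (fun p : ℝ × Ω => Y' p.1 p.2) ((volume.restrict (Icc a b)).prod P) := by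
  have hm := h.measurable_uncurry_deriv
  rw [integrable_prod_iff hm.aestronglyMeasurable]
  refine ⟨Eventually.of_forall hi, (integrable_const C).mono'
    hm.norm.aestronglyMeasurable.integral_prod_right' (Eventually.of_forall fun t => ?_)⟩
  rw [Real.norm_of_nonneg (integral_nonneg fun ω => norm_nonneg _)]
  exact hC t

theorem norm_fourierPlus_meanCrossings_sub_le [IsFiniteMeasure P] (h : HasC1Paths Y Y')
    {a b : ℝ} (hab : a ≤ b)
    (hint : Integrable (fun p : ℝ × Ω => Y' p.1 p.2) ((volume.restrict (Icc a b)).prod P))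
    {u B : ℝ} {c : ℂ}
    (hB : ∀ t, ‖∫ ω, cexp (I * u * Y t ω) * (|Y' t ω| : ℝ) ∂P - c‖ ≤ B) :
    ‖fourierPlus (fun α => (meanCrossings P Y a b α).toReal) u - (b - a) • c‖ ≤ B * (b - a) := by
  have hconst : ∫ _ in Icc a b, c = (b - a) • c := by
    rw [setIntegral_const, Real.volume_real_Icc_of_le hab]
  rw [h.fourierPlus_meanCrossings hint, ← hconst,
    ← integral_sub (h.integrable_cexp_mul_abs_deriv hint u).integral_prod_left
      (integrable_const c), ← Real.volume_real_Icc_of_le hab]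
  exact norm_setIntegral_le_of_norm_le_const measure_Icc_lt_top fun t _ => hB t

end HasC1Paths

end MeanCrossings

section ShotNoise

variable {f g : ℝ → ℝ} {lam : ℝ}

/-- The kernel `s ↦ f (t - s) / √lam`. Its compensated integral is, for `f = g` and `f = g'`, the
normalized shot noise at time `t` and its derivative. -/
noncomputable def normalizedKernel (f : ℝ → ℝ) (lam t s : ℝ) : ℝ :=
  f (t - s) / √lam

theorem integrable_normalizedKernel (hf : Integrable f) (lam t : ℝ) :
    Integrable (normalizedKernel f lam t) (ENNReal.ofReal lam • volume) :=
  ((hf.comp_sub_left t).smul_measure ENNReal.ofReal_ne_top).div_const _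

theorem integral_sub_left_smul_volume (f : ℝ → ℝ) (hlam : 0 ≤ lam) (t : ℝ) :
    ∫ s, f (t - s) ∂(ENNReal.ofReal lam • volume) = lam * ∫ s, f s := by
  rw [integral_smul_measure, ENNReal.toReal_ofReal hlam, integral_sub_left_eq_self f volume t,
    smul_eq_mul]

theorem integral_normalizedKernel_mul (hlam : 0 < lam) (f g : ℝ → ℝ) (t : ℝ) :
    ∫ s, normalizedKernel f lam t s * normalizedKernel g lam t s ∂(ENNReal.ofReal lam • volume)
      = ∫ s, f s * g s := by
  simp only [normalizedKernel, div_mul_div_comm, Real.mul_self_sqrt hlam.le]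
  rw [integral_div, integral_sub_left_smul_volume (fun s => f s * g s) hlam.le,
    mul_div_cancel_left₀ _ hlam.ne']

theorem integral_abs_normalizedKernel (hlam : 0 ≤ lam) (f : ℝ → ℝ) (t : ℝ) :
    ∫ s, |normalizedKernel f lam t s| ∂(ENNReal.ofReal lam • volume)
      = lam * (∫ s, |f s|) / √lam := by
  simp only [normalizedKernel, abs_div, abs_of_nonneg (Real.sqrt_nonneg lam)]
  rw [integral_div, integral_sub_left_smul_volume (fun s => |f s|) hlam]

theorem compensatedIntegral_normalizedKernel {Ω : Type*} (τ : ℕ → Ω → ℝ) (hlam : 0 ≤ lam)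
    (f : ℝ → ℝ) (t : ℝ) (ω : Ω) :
    compensatedIntegral τ (ENNReal.ofReal lam • volume) (normalizedKernel f lam t) ω
      = (∑' i, f (t - τ i ω) - lam * ∫ s, f s) / √lam := by
  simp only [compensatedIntegral, normalizedKernel]
  rw [tsum_div_const, integral_div, integral_sub_left_smul_volume f hlam, sub_div]

namespace KernelAssumption

theorem integral_deriv_eq_zero (hg : KernelAssumption g) : ∫ s, deriv g s = 0 :=
  integral_eq_zero_of_hasDerivAt_of_integrable hg.hasDerivAt hg.integrable_deriv hg.integrable

theorem exists_abs_le (hg : KernelAssumption g) :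
    ∃ M, 0 < M ∧ (∀ s, |g s| ≤ M) ∧ ∀ s, |deriv g s| ≤ M := by
  obtain ⟨M₀, hM₀, hb₀⟩ := exists_abs_le_of_integrable_deriv hg.hasDerivAt hg.continuous_deriv
    hg.integrable hg.integrable_deriv
  obtain ⟨M₁, hM₁, hb₁⟩ := exists_abs_le_of_integrable_deriv hg.hasDerivAt_deriv
    hg.continuous_deriv_deriv hg.integrable_deriv hg.integrable_deriv_deriv
  exact ⟨M₀ + M₁ + 1, by positivity, fun s => (hb₀ s).trans (by linarith),
    fun s => (hb₁ s).trans (by linarith)⟩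

theorem integral_mul_deriv_eq_zero (hg : KernelAssumption g) : ∫ s, g s * deriv g s = 0 := by
  obtain ⟨M, -, hb₀, hb₁⟩ := hg.exists_abs_le
  have hgg : Integrable fun s => g s * g s :=
    hg.integrable.mul_bdd hg.integrable.1 (Eventually.of_forall hb₀)
  have hgg' : Integrable fun s => g s * deriv g s :=
    hg.integrable.mul_bdd hg.integrable_deriv.1 (Eventually.of_forall hb₁)
  have hparts := integral_mul_deriv_eq_deriv_mul_of_integrable (fun s _ => hg.hasDerivAt s)
    (fun s _ => hg.hasDerivAt s) hgg' (mul_comm g (deriv g) ▸ hgg') hgg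
  simp only [mul_comm (deriv g _)] at hparts
  exact self_eq_neg.1 hparts

theorem exists_boundedOrthogonalPair (hg : KernelAssumption g) :
    ∃ M, 0 < M ∧ ∀ lam, 0 < lam → ∀ t, BoundedOrthogonalPair (normalizedKernel g lam t)
      (normalizedKernel (deriv g) lam t) (ENNReal.ofReal lam • volume) (M / √lam)
      (∫ s, g s ^ 2) (∫ s, deriv g s ^ 2) := by
  obtain ⟨M, hM, hb₀, hb₁⟩ := hg.exists_abs_le
  have habs {f : ℝ → ℝ} (hf : ∀ s, |f s| ≤ M) (lam t s : ℝ) :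
      |normalizedKernel f lam t s| ≤ M / √lam := by
    rw [normalizedKernel, abs_div, abs_of_nonneg (Real.sqrt_nonneg lam)]
    gcongr
    exact hf _
  exact ⟨M, hM, fun lam hlam t =>
    { integrable_fst := integrable_normalizedKernel hg.integrable lam t
      integrable_snd := integrable_normalizedKernel hg.integrable_deriv lam t
      pos := by positivity
      abs_fst_le := habs hb₀ lam t
      abs_snd_le := habs hb₁ lam t
      orthogonal := by rw [integral_normalizedKernel_mul hlam, hg.integral_mul_deriv_eq_zero]
      integral_sq_fst := by simp only [sq, integral_normalizedKernel_mul hlam]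
      integral_sq_snd := by simp only [sq, integral_normalizedKernel_mul hlam] }⟩

end KernelAssumption

namespace IsPoissonPointProcess

variable {Ω : Type*} [MeasurableSpace Ω] {P : Measure Ω} [IsProbabilityMeasure P]
  {τ β : ℕ → Ω → ℝ}

theorem ae_normalizedProcess_shotNoise_eq
    (hτ : IsPoissonPointProcess τ (ENNReal.ofReal lam • volume) P) (hlam : 0 ≤ lam)
    (hβ : ∀ i, ∀ᵐ ω ∂P, β i ω = 1) (hg : Integrable g) :
    ∀ᵐ ω ∂P, ∀ t, normalizedProcess P lam (shotNoise g β τ) t ω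
      = (∑' i, g (t - τ i ω) - lam * ∫ s, g s) / √lam := by
  have hshot : ∀ᵐ ω ∂P, ∀ t, shotNoise g β τ t ω = ∑' i, g (t - τ i ω) := by
    filter_upwards [ae_all_iff.2 hβ] with ω hω t
    simp only [shotNoise, hω, one_mul]
  have hmean (t : ℝ) : ∫ ω, shotNoise g β τ t ω ∂P = lam * ∫ s, g s := by
    rw [integral_congr_ae (hshot.mono fun ω hω => hω t), ← integral_sub_left_smul_volume g hlam t]
    exact hτ.integral_tsum_comp ((hg.comp_sub_left t).smul_measure ENNReal.ofReal_ne_top)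
  filter_upwards [hshot] with ω hω t
  rw [normalizedProcess, hmean, hω]

theorem exists_hasC1Paths_normalizedProcess
    (hτ : IsPoissonPointProcess τ (ENNReal.ofReal lam • volume) P) (hlam : 0 ≤ lam)
    (hβ : ∀ i, ∀ᵐ ω ∂P, β i ω = 1) (hg : KernelAssumption g) :
    ∃ Y Y' : ℝ → Ω → ℝ, HasC1Paths Y Y' ∧
      (∀ᵐ ω ∂P, ∀ t, normalizedProcess P lam (shotNoise g β τ) t ω = Y t ω) ∧
      (∀ t, Y t =ᵐ[P]
        compensatedIntegral τ (ENNReal.ofReal lam • volume) (normalizedKernel g lam t)) ∧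
      ∀ t, Y' t =ᵐ[P]
        compensatedIntegral τ (ENNReal.ofReal lam • volume) (normalizedKernel (deriv g) lam t) := by
  obtain ⟨X, X', hX, hXeq⟩ := hτ.exists_hasC1Paths_ae_eq_tsum hg
  refine ⟨_, _, hX.sub_const_div_const (lam * ∫ s, g s) (√lam), ?_, fun t => ?_, fun t => ?_⟩
  · filter_upwards [hτ.ae_normalizedProcess_shotNoise_eq hlam hβ hg.integrable, hXeq]
      with ω hω hXω t
    rw [hω, (hXω t).1]
  · filter_upwards [hXeq] with ω hXω
    rw [compensatedIntegral_normalizedKernel τ hlam, (hXω t).1]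
  · filter_upwards [hXeq] with ω hXω
    rw [compensatedIntegral_normalizedKernel τ hlam, (hXω t).2, hg.integral_deriv_eq_zero,
      mul_zero, sub_zero]

theorem integrable_prod_of_ae_eq_compensatedIntegral
    (hτ : IsPoissonPointProcess τ (ENNReal.ofReal lam • volume) P) (hlam : 0 ≤ lam)
    (hf : Integrable f) {Y Y' : ℝ → Ω → ℝ} (hY : HasC1Paths Y Y')
    (hY' : ∀ t, Y' t =ᵐ[P]
      compensatedIntegral τ (ENNReal.ofReal lam • volume) (normalizedKernel f lam t)) (a b : ℝ) :
    Integrable (fun p : ℝ × Ω => Y' p.1 p.2) ((volume.restrict (Icc a b)).prod P) := by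
  refine hY.integrable_prod_of_integral_abs_le
    (fun t => (hτ.integrable_compensatedIntegral (integrable_normalizedKernel hf lam t)).congr
      (hY' t).symm) (C := 2 * (lam * (∫ s, |f s|) / √lam)) (fun t => ?_) a b
  rw [← integral_abs_normalizedKernel hlam f t,
    integral_congr_ae ((hY' t).mono fun ω hω => congrArg abs hω)]
  exact hτ.integral_abs_compensatedIntegral_le (integrable_normalizedKernel hf lam t)

end IsPoissonPointProcess

end ShotNoise

theorem proposition8 (g : ℝ → ℝ) (hg : KernelAssumption g) :
    ∃ a₁ a₂ a₃ : ℝ, 0 < a₁ ∧ 0 < a₂ ∧ 0 < a₃ ∧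
      ∀ (Ω : Type*) [MeasurableSpace Ω] (P : Measure Ω) [IsProbabilityMeasure P]
        (lam : ℝ) (_ : 0 < lam) (τ β : ℕ → Ω → ℝ)
        (_ : IsPoissonPointProcess τ (ENNReal.ofReal lam • volume) P)
        (_ : ∀ i, ∀ᵐ ω ∂P, β i ω = 1)
        (Z : ℝ → Ω → ℝ) (_ : Z = normalizedProcess P lam (shotNoise g β τ)),
        (∀ᵐ α : ℝ, meanCrossings P Z 0 1 α ≠ ⊤) ∧
        Integrable (fun α => (meanCrossings P Z 0 1 α).toReal) ∧
        ∀ u : ℝ, |u| < a₁ * √lam →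
          ‖fourierPlus (fun α => (meanCrossings P Z 0 1 α).toReal) u
              - ((√(2 * (∫ s, deriv g s ^ 2) / Real.pi)
                  * Real.exp (-(∫ s, g s ^ 2) * u ^ 2 / 2) : ℝ) : ℂ)‖
            ≤ (a₂ + a₃ * |u|) / √lam := by
  obtain ⟨M, hM, hpair⟩ := hg.exists_boundedOrthogonalPair
  set C := M * gaussianErrorConst (∫ s, g s ^ 2) (∫ s, deriv g s ^ 2) with hC_def
  have hC : 0 < C := mul_pos hM (gaussianErrorConst_pos (integral_nonneg fun s => sq_nonneg (g s))
    (integral_nonneg fun s => sq_nonneg (deriv g s)))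
  refine ⟨1 / (2 * M), C, C, by positivity, hC, hC, ?_⟩
  rintro Ω _ P _ lam hlam τ β hτ hβ Z rfl
  obtain ⟨Y, Y', hY, hZY, hYeq, hY'eq⟩ := hτ.exists_hasC1Paths_normalizedProcess hlam.le hβ hg
  have hint := hτ.integrable_prod_of_ae_eq_compensatedIntegral hlam.le hg.integrable_deriv hY hY'eq
    0 1
  rw [meanCrossings_congr_ae hZY]
  refine ⟨hY.ae_meanCrossings_ne_top hint, hY.integrable_toReal_meanCrossings hint, fun u hu => ?_⟩
  have hu' : |u| * (2 * (M / √lam)) ≤ 1 := by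
    rw [one_div_mul_eq_div, lt_div_iff₀ (by positivity)] at hu
    rw [← mul_div_assoc, ← mul_div_assoc, div_le_one (by positivity)]
    exact hu.le
  have hbound := hY.norm_fourierPlus_meanCrossings_sub_le zero_le_one hint (u := u) fun t => by
    rw [integral_congr_ae (((hYeq t).and (hY'eq t)).mono fun ω hω => by rw [hω.1, hω.2])]
    exact hτ.norm_integral_cexp_mul_abs_sub_le (hpair lam hlam t) hu'
  rw [sub_zero, one_smul, mul_one] at hbound
  rw [neg_mul, neg_div]
  exact hbound.trans_eq (by rw [hC_def]; ring)
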